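/- Let $\mathbb K=\mathbb R$ or $\mathbb C$, let $m\ge 1$, let $X_1,\dots,X_m,Y$ be Banach spaces over $\mathbb K$ and let $T:X_1\times\cdots\times X_m\to Y$ be $m$-linear. For $p\ge 1$ and a sequence $x=(x_i)_{i\in\mathbb N}$ in a Banach space $X$ put $w_p(x)=\sup_{x^*\in X^*,\ \|x^*\|\le 1}\big(\sum_{i}|x^*(x_i)|^p\big)^{1/p}\in[0,\infty]$. For $r,p\geq 1$, a linear map $u:X\to Y$ is $(r,p)$-summing if there is $C>0$ with $\big(\sum_i\|u(x_i)\|^r\big)^{1/r}\le C\,w_p(x)$ for all sequences $x$ in $X$. The map $T$ is $(r,p)$-summing in the $k$-th coordinate if, for every choice of the other coordinates $z_j\in X_j$, $j\ne k$, the linear map $x\mapsto T(z_1,\dots,z_{k-1},x,z_{k+1},\dots,z_m)$ is $(r,p)$-summing. For $r\ge 1$ and $\mathbf p=(p_1,\dots,p_m)\in[1,\infty)^m$, $T$ is multiple $(r,\mathbf p)$-summing if there is $C>0$ such that for all sequences $x(j)=(x_i(j))_{i\in\mathbb N}$ in $X_j$, $1\le j\le m$, $$\Big(\sum_{\mathbf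 i\in\mathbb N^m}\|T(x_{i_1}(1),\dots,x_{i_m}(m))\|^r\Big)^{1/r}\le C\,w_{p_1}(x(1))\cdots w_{p_m}(x(m)).$$ The space $Y$ has cotype $q\in[2,\infty)$ if there is a constant $C$ such that for all $n$ and all $y_1,\dots,y_n\in Y$ one has $\big(\sum_{i}\|y_i\|^q\big)^{1/q}\le C\big(\mathbb E\|\sum_{i}\varepsilon_iy_i\|^2\big)^{1/2}$, where $\varepsilon_1,\dots,\varepsilon_n$ are independent uniformly distributed signs $\pm1$. For $p\in[1,\infty)$, $p^*$ denotes the conjugate exponent, $\frac1{p^*}=1-\frac1p$. Assume that $Y$ has cotype $q$, let $\mathbf p\in[1,\infty)^m$ and $r_1,\dots,r_m\in[1,\infty)$, and assume that, for every $k=1,\dots,m$, $T$ is $(r_k,p_k)$-summing in the $k$-th coordinate. Assume that there is $\theta\le 0$ such that $\frac1{r_k}-\frac1{p_k}=\theta$ for all $k$, and set $$\frac1\gamma=1+\theta-\sum_{k=1}^m\frac1{p_k^*}.$$ 1. If $\gamma\in(0,q)$, then $T$ is multiple $(s,\mathbf p)$-summing, where $\displaystyle \frac1s=\frac{m-1}{mq}+\frac1{\gamma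 m}$. 2. If $\gamma\in[q,\infty)$, then $T$ is multiple $(\gamma,\mathbf p)$-summing. -/

import Mathlib

open scoped NNReal ENNReal

/-- The weak `ℓ^p`-norm `w_p(x) = sup_{‖φ‖ ≤ 1} (∑ᵢ |φ(xᵢ)|^p)^{1/p}` of a sequence `x` in `X`,
the supremum running over the closed unit ball of the dual; it takes values in `[0, ∞]`. -/
noncomputable def weakLpNorm (𝕜 : Type*) {X : Type*} [RCLike 𝕜] [NormedAddCommGroup X]
    [NormedSpace 𝕜 X] (p : ℝ) (x : ℕ → X) : ℝ≥0∞ :=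
  ⨆ (φ : StrongDual 𝕜 X) (_ : ‖φ‖ ≤ 1), (∑' i : ℕ, ‖φ (x i)‖ₑ ^ p) ^ (1 / p)

/-- A linear map `u : X → Y` is `(r, p)`-summing: for some constant `C > 0`,
`(∑ᵢ ‖u(xᵢ)‖^r)^{1/r} ≤ C w_p(x)` for every sequence `x` in `X`. -/
def IsSumming {𝕜 X Y : Type*} [RCLike 𝕜] [NormedAddCommGroup X] [NormedSpace 𝕜 X]
    [NormedAddCommGroup Y] [NormedSpace 𝕜 Y] (r p : ℝ) (u : X →ₗ[𝕜] Y) : Prop :=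
  ∃ C : ℝ≥0, 0 < C ∧ ∀ x : ℕ → X,
    (∑' i : ℕ, ‖u (x i)‖ₑ ^ r) ^ (1 / r) ≤ C * weakLpNorm 𝕜 p x

/-- An `m`-linear map `T` is multiple `(r, 𝐩)`-summing: for some constant `C > 0`,
`(∑_{i ∈ ℕ^m} ‖T(x_{i₁}(1), …, x_{i_m}(m))‖^r)^{1/r} ≤ C w_{p₁}(x(1)) ⋯ w_{p_m}(x(m))`
for all sequences `x(j)` in `X_j`. (In `[0, ∞]` one has `0 * ∞ = 0`; this is harmless, as
`w_p(x) = 0` forces `x = 0`, hence a vanishing left-hand side.) -/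
def IsMultipleSumming {𝕜 : Type*} [RCLike 𝕜] {m : ℕ} {X : Fin m → Type*} {Y : Type*}
    [∀ j, NormedAddCommGroup (X j)] [∀ j, NormedSpace 𝕜 (X j)]
    [NormedAddCommGroup Y] [NormedSpace 𝕜 Y]
    (r : ℝ) (p : Fin m → ℝ) (T : MultilinearMap 𝕜 X Y) : Prop :=
  ∃ C : ℝ≥0, 0 < C ∧ ∀ x : (j : Fin m) → ℕ → X j,
    (∑' i : Fin m → ℕ, ‖T (fun j => x j (i j))‖ₑ ^ r) ^ (1 / r)
      ≤ C * ∏ j, weakLpNorm 𝕜 (p j) (x j)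

/-- `T` is `(r, p)`-summing in the `k`-th coordinate: whenever the coordinates other than the
`k`-th are fixed, the resulting linear map `X_k → Y` is `(r, p)`-summing. Here
`T.toLinearMap z k` is `x ↦ T(z₁, …, z_{k-1}, x, z_{k+1}, …, z_m)`; it ignores `z_k`. -/
def IsSummingInCoord {𝕜 : Type*} [RCLike 𝕜] {m : ℕ} {X : Fin m → Type*} {Y : Type*}
    [∀ j, NormedAddCommGroup (X j)] [∀ j, NormedSpace 𝕜 (X j)]
    [NormedAddCommGroup Y] [NormedSpace 𝕜 Y]
    (r p : ℝ) (k : Fin m) (T : MultilinearMap 𝕜 X Y) : Prop :=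
  ∀ z : (j : Fin m) → X j, IsSumming r p (T.toLinearMap z k)

/-- `Y` has cotype `q`, `2 ≤ q < ∞`: for some constant `C`, all `n` and all `y₁, …, yₙ` in `Y`,
`(∑ᵢ ‖yᵢ‖^q)^{1/q} ≤ C (𝔼 ‖∑ᵢ εᵢ yᵢ‖²)^{1/2}`, with independent uniform signs `εᵢ = ±1`; the
expectation is written as the average over the `2^n` choices of signs. -/
def HasCotype (Y : Type*) [NormedAddCommGroup Y] (q : ℝ) : Prop :=
  2 ≤ q ∧ ∃ C : ℝ, ∀ (n : ℕ) (y : Fin n → Y),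
    (∑ i, ‖y i‖ ^ q) ^ (1 / q) ≤
      C * √((∑ ε : Fin n → ℤˣ, ‖∑ i, (ε i : ℤ) • y i‖ ^ 2) / 2 ^ n)

/-- The reciprocal `1 / p^* = 1 - 1 / p` of the exponent conjugate to `p ∈ [1, ∞)`, so that it
equals `0` for `p = 1`, where `p^* = ∞`. -/
noncomputable def invConj (p : ℝ) : ℝ := 1 - 1 / p

/-! Put b(i) = (‖T(x_{i_1}(1), …, x_{i_m}(m))‖ / K)^q for finite sequences of weak norm at most 1.
The analytic input is one family of inequalities for b. If w_j ≥ 0 has total mass at most 1, then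
w_j^{1/p_j^*} x(j) is weakly 1-summable, so its Rademacher sums lie in the unit ball. Fixing i_k,
cotype in product form bounds the ℓ^q norm of the weighted array by an average of ‖T‖ over such
sums. Summing over i_k then uses the summing inequality in the k-th slot, which is uniform on unit
balls by Banach–Steinhaus (`exists_uniform_summing_bound`). The outcome is `WeightedMixedBound` with
τ_j = q/p_j^* and ρ_k = r_k/q (`exists_weightedMixedBound`).

The rest concerns nonnegative arrays. With δ = γ/q the hypotheses become ρ_k ∑_{j≠k} τ_j = 1 - ρ_k/δ
for all k. The weights are free, so they are built from the array itself; Hölder then yields M ≤ M^e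
with e < 1 for the quantity M to be bounded, hence M ≤ 1.

For δ < 1, powers of the marginals as weights bound all mixed (δ, 1)-norms
(`WeightedMixedBound.sum_marginal_rpow_le`), and Blei interpolation (`sum_rpow_le_one_of_mixed`)
gives the exponent s. For δ ≥ 1, `WeightedMixedBound.sum_rpow_le_one` spends part of the weights on
marginals of b^δ and so reduces to δ = 1 (`WeightedMixedBound.sum_le_one`), unless some ρ_k ≥ 1,
where these weights alone suffice. -/

/-! ### Poincaré inequalities on the discrete cube -/

section Cube

/-- The cube point `ε` with the `i`-th sign flipped. -/
def flipSign {n : ℕ} (i : Fin n) (ε : Fin n → ℤˣ) : Fin n → ℤˣ :=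
  Function.update ε i (-ε i)

/-- (Unnormalised) Dirichlet energy of a function on the discrete cube. -/
def cubeEnergy {n : ℕ} (f : (Fin n → ℤˣ) → ℝ) : ℝ :=
  ∑ i, ∑ ε, f ε * (f ε - f (flipSign i ε))

lemma flipSign_zero_cons {n : ℕ} (e : ℤˣ) (ε : Fin n → ℤˣ) :
    flipSign 0 (Fin.cons e ε : Fin (n + 1) → ℤˣ) = Fin.cons (-e) ε := by
  simp [flipSign]

lemma flipSign_succ_cons {n : ℕ} (i : Fin n) (e : ℤˣ) (ε : Fin n → ℤˣ) :
    flipSign i.succ (Fin.cons e ε : Fin (n + 1) → ℤˣ) = Fin.cons e (flipSign i ε) := by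
  simp [flipSign, Fin.cons_update]

lemma sum_fin_succ_pi {α M : Type*} [Fintype α] [AddCommMonoid M] {n : ℕ}
    (f : (Fin (n + 1) → α) → M) :
    ∑ ε, f ε = ∑ a, ∑ ε : Fin n → α, f (Fin.cons a ε) := by
  rw [← (Fin.consEquiv (fun _ => α)).sum_comp, Fintype.sum_prod_type]
  rfl

lemma sum_units_int {M : Type*} [AddCommMonoid M] (f : ℤˣ → M) : ∑ e, f e = f 1 + f (-1) := by
  have : (Finset.univ : Finset ℤˣ) = {1, -1} := rfl
  rw [this, Finset.sum_pair (by decide)]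

lemma sum_cube_succ {n : ℕ} (f : (Fin (n + 1) → ℤˣ) → ℝ) :
    ∑ ε, f ε = ∑ ε : Fin n → ℤˣ, (f (Fin.cons 1 ε) + f (Fin.cons (-1) ε)) := by
  rw [sum_fin_succ_pi, sum_units_int, Finset.sum_add_distrib]

/-- Flips of the first sign only see h and contribute 4 ∑ h²; for the other flips the cross terms
between g and h cancel. This drives the inductions on the dimension. -/
lemma cubeEnergy_succ {n : ℕ} (f : (Fin (n + 1) → ℤˣ) → ℝ) (g h : (Fin n → ℤˣ) → ℝ)
    (hg : ∀ ε, f (Fin.cons 1 ε) = g ε + h ε) (hh : ∀ ε, f (Fin.cons (-1) ε) = g ε - h ε) :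
    cubeEnergy f = 4 * ∑ ε, h ε ^ 2 + 2 * cubeEnergy g + 2 * cubeEnergy h := by
  unfold cubeEnergy
  rw [Fin.sum_univ_succ, sum_cube_succ, add_assoc]
  congr 1
  · rw [Finset.mul_sum]
    refine Finset.sum_congr rfl fun ε _ => ?_
    simp only [flipSign_zero_cons, hg, hh, neg_neg]
    ring
  · rw [Finset.mul_sum, Finset.mul_sum, ← Finset.sum_add_distrib]
    refine Finset.sum_congr rfl fun i _ => ?_
    rw [sum_cube_succ, Finset.mul_sum, Finset.mul_sum, ← Finset.sum_add_distrib]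
    refine Finset.sum_congr rfl fun ε _ => ?_
    simp only [flipSign_succ_cons, hg, hh]
    ring

lemma exists_cube_decomp {n : ℕ} (f : (Fin (n + 1) → ℤˣ) → ℝ) :
    ∃ g h : (Fin n → ℤˣ) → ℝ, (∀ ε, f (Fin.cons 1 ε) = g ε + h ε) ∧
      (∀ ε, f (Fin.cons (-1) ε) = g ε - h ε) ∧
      (∀ ε, g ε = (f (Fin.cons 1 ε) + f (Fin.cons (-1) ε)) / 2) ∧
      (∀ ε, h ε = (f (Fin.cons 1 ε) - f (Fin.cons (-1) ε)) / 2) :=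
  ⟨fun ε => (f (Fin.cons 1 ε) + f (Fin.cons (-1) ε)) / 2,
   fun ε => (f (Fin.cons 1 ε) - f (Fin.cons (-1) ε)) / 2,
   fun _ => by ring, fun _ => by ring, fun _ => rfl, fun _ => rfl⟩

lemma cubeEnergy_nonneg : ∀ {n : ℕ} (f : (Fin n → ℤˣ) → ℝ), 0 ≤ cubeEnergy f
  | 0, f => by simp [cubeEnergy]
  | n + 1, f => by
    obtain ⟨g, h, hg, hh, -⟩ := exists_cube_decomp f
    rw [cubeEnergy_succ f g h hg hh]
    have := cubeEnergy_nonneg g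
    have := cubeEnergy_nonneg h
    positivity

lemma sum_cube_decomp {n : ℕ} {f : (Fin (n + 1) → ℤˣ) → ℝ} {g h : (Fin n → ℤˣ) → ℝ}
    (hg : ∀ ε, f (Fin.cons 1 ε) = g ε + h ε) (hh : ∀ ε, f (Fin.cons (-1) ε) = g ε - h ε) :
    ∑ ε, f ε = 2 * ∑ ε, g ε ∧ ∑ ε, f ε ^ 2 = 2 * ∑ ε, g ε ^ 2 + 2 * ∑ ε, h ε ^ 2 := by
  constructor
  · rw [sum_cube_succ, Finset.mul_sum]
    refine Finset.sum_congr rfl fun ε _ => ?_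
    rw [hg, hh]; ring
  · rw [sum_cube_succ, Finset.mul_sum, Finset.mul_sum, ← Finset.sum_add_distrib]
    refine Finset.sum_congr rfl fun ε _ => ?_
    rw [hg, hh]; ring

/-- Poincaré's inequality on the discrete cube. -/
lemma poincare_cube : ∀ {n : ℕ} (f : (Fin n → ℤˣ) → ℝ),
    2 ^ n * ∑ ε, f ε ^ 2 - (∑ ε, f ε) ^ 2 ≤ 2 ^ n * cubeEnergy f / 2
  | 0, f => by simp [cubeEnergy]
  | n + 1, f => by
    obtain ⟨g, h, hg, hh, -⟩ := exists_cube_decomp f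
    obtain ⟨h1, h2⟩ := sum_cube_decomp hg hh
    rw [cubeEnergy_succ f g h hg hh, h1, h2, pow_succ]
    have i1 := poincare_cube g
    have i2 : (0 : ℝ) ≤ 2 ^ n * cubeEnergy h := mul_nonneg (by positivity) (cubeEnergy_nonneg h)
    linarith

/-- Poincaré's inequality for even functions on the discrete cube, with the improved constant. -/
lemma poincare_cube_even : ∀ {n : ℕ} (f : (Fin n → ℤˣ) → ℝ), (∀ ε, f (-ε) = f ε) →
    2 * (2 ^ n * ∑ ε, f ε ^ 2 - (∑ ε, f ε) ^ 2) ≤ 2 ^ n * cubeEnergy f / 2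
  | 0, f, _ => by simp [cubeEnergy]
  | n + 1, f, hf => by
    obtain ⟨g, h, hg, hh, hg', hh'⟩ := exists_cube_decomp f
    obtain ⟨h1, h2⟩ := sum_cube_decomp hg hh
    rw [cubeEnergy_succ f g h hg hh, h1, h2, pow_succ]
    have hc : ∀ e (ε : Fin n → ℤˣ), f (Fin.cons e (-ε)) = f (Fin.cons (-e) ε) := by
      intro e ε
      rw [← hf]
      congr 1
      funext j
      refine Fin.cases ?_ (fun j => ?_) j <;> simp
    have i1 := poincare_cube_even g (fun ε => by rw [hg', hg', hc, hc, neg_neg, add_comm])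
    -- Evenness of f makes g even and h odd. So h has mean zero, and the ordinary inequality for h
    -- supplies the extra factor 2 that g gets from the induction.
    have i2 := poincare_cube h
    have i3 : ∑ ε, h ε = 0 := by
      have : ∑ ε, h (-ε) = ∑ ε, h ε := Equiv.sum_comp (Equiv.neg (Fin n → ℤˣ)) h
      have h4 : ∑ ε, h (-ε) = - ∑ ε, h ε := by
        rw [← Finset.sum_neg_distrib]
        exact Finset.sum_congr rfl fun ε _ => by rw [hh', hh', hc, hc, neg_neg]; ring
      linarith
    rw [i3] at i2
    linarith

end Cube

/-! ### Kahane's inequality and iterated cotype -/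

section Cotype

/-- The Khintchine–Kahane inequality comparing the first and second moments of a Rademacher sum,
with the optimal constant `√2` (Latała–Oleszkiewicz). -/
lemma sum_sq_norm_rademacher_le {Y : Type*} [NormedAddCommGroup Y] [NormedSpace ℝ Y]
    {n : ℕ} (y : Fin n → Y) :
    2 ^ n * ∑ ε : Fin n → ℤˣ, ‖∑ i, (ε i : ℤ) • y i‖ ^ 2 ≤
      2 * (∑ ε : Fin n → ℤˣ, ‖∑ i, (ε i : ℤ) • y i‖) ^ 2 := by
  set S : (Fin n → ℤˣ) → Y := fun ε => ∑ i, (ε i : ℤ) • y i with hS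
  have hev : ∀ ε, ‖S (-ε)‖ = ‖S ε‖ := by
    intro ε
    rw [← norm_neg (S ε)]
    simp [hS]
  have hflip : ∀ ε i, S (flipSign i ε) = S ε - (2 * (ε i : ℤ)) • y i := by
    intro ε i
    have : ∀ j, ((flipSign i ε j : ℤˣ) : ℤ) • y j =
        (ε j : ℤ) • y j - (if j = i then (2 * (ε i : ℤ)) • y i else 0) := by
      intro j
      by_cases hj : j = i
      · subst hj
        simp only [flipSign, Function.update_self, if_true, Units.val_neg]
        rw [← sub_smul]; congr 1; ring
      · simp [flipSign, hj]
    simp only [hS, this, Finset.sum_sub_distrib, Finset.sum_ite_eq', Finset.mem_univ, if_true]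
  have hE : ∀ ε, ∑ i, (‖S ε‖ - ‖S (flipSign i ε)‖) ≤ 2 * ‖S ε‖ := by
    intro ε
    -- Flipping each sign once, in turn, removes 2S(ε) in total; the triangle inequality then bounds
    -- the energy of ‖S‖ by 2 ∑ ‖S‖².
    have h1 : n • S ε = ∑ i, S (flipSign i ε) + (2 : ℕ) • S ε := by
      simp only [hflip, Finset.sum_sub_distrib, mul_smul, ← Finset.smul_sum]
      simp only [Finset.sum_const, Finset.card_univ, Fintype.card_fin]
      rw [show ∑ i, (ε i : ℤ) • y i = S ε from rfl, ← natCast_zsmul _ 2]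
      simp
    have h2 : n * ‖S ε‖ ≤ ∑ i, ‖S (flipSign i ε)‖ + 2 * ‖S ε‖ := by
      have hsm : ∀ (k : ℕ) (v : Y), ‖k • v‖ = k * ‖v‖ := fun k v => by
        rw [← Nat.cast_smul_eq_nsmul ℝ, norm_smul, Real.norm_natCast]
      have h3 := hsm n (S ε)
      have h4 := hsm 2 (S ε)
      rw [h1] at h3
      rw [Nat.cast_ofNat] at h4
      rw [← h3, ← h4]
      exact (norm_add_le _ _).trans (by gcongr; exact norm_sum_le _ _)
    rw [Finset.sum_sub_distrib]
    simp only [Finset.sum_const, Finset.card_univ, Fintype.card_fin, nsmul_eq_mul]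
    linarith
  have key := poincare_cube_even (fun ε => ‖S ε‖) hev
  have hle : cubeEnergy (fun ε => ‖S ε‖) ≤ ∑ ε, 2 * ‖S ε‖ ^ 2 := by
    unfold cubeEnergy
    rw [Finset.sum_comm]
    refine Finset.sum_le_sum fun ε _ => ?_
    rw [← Finset.mul_sum]
    nlinarith [hE ε, norm_nonneg (S ε)]
  rw [← Finset.mul_sum] at hle
  have h2 : (2 : ℝ) ^ n * cubeEnergy (fun ε => ‖S ε‖) ≤ 2 ^ n * (2 * ∑ ε, ‖S ε‖ ^ 2) :=
    mul_le_mul_of_nonneg_left hle (by positivity)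
  linarith

/-- Cotype `q`, with the Rademacher average taken in `L¹` instead of `L²`. -/
lemma HasCotype.exists_l1 {Y : Type*} [NormedAddCommGroup Y] [NormedSpace ℝ Y] {q : ℝ} (h : HasCotype Y q) :
    ∃ C : ℝ, 0 ≤ C ∧ ∀ (n : ℕ) (y : Fin n → Y),
      (∑ i, ‖y i‖ ^ q) ^ (1 / q) ≤
        C * ((∑ ε : Fin n → ℤˣ, ‖∑ i, (ε i : ℤ) • y i‖) / 2 ^ n) := by
  obtain ⟨-, C, hC⟩ := h
  refine ⟨|C| * √2, by positivity, fun n y => (hC n y).trans ?_⟩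
  have key := sum_sq_norm_rademacher_le y
  set A := ∑ ε : Fin n → ℤˣ, ‖∑ i, (ε i : ℤ) • y i‖ ^ 2
  set B := ∑ ε : Fin n → ℤˣ, ‖∑ i, (ε i : ℤ) • y i‖
  have hB : 0 ≤ B := by positivity
  have h2 : √(A / 2 ^ n) ≤ √2 * (B / 2 ^ n) := by
    rw [← Real.sqrt_sq (show 0 ≤ B / 2 ^ n by positivity), ← Real.sqrt_mul (by norm_num)]
    refine Real.sqrt_le_sqrt ?_
    rw [div_le_iff₀ (by positivity), div_pow]
    rw [show 2 * (B ^ 2 / (2 ^ n) ^ 2) * 2 ^ n = 2 * B ^ 2 / 2 ^ n by field_simp]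
    rw [le_div_iff₀ (by positivity)]
    linarith
  calc C * √(A / 2 ^ n) ≤ |C| * (√2 * (B / 2 ^ n)) :=
        mul_le_mul (le_abs_self C) h2 (Real.sqrt_nonneg _) (abs_nonneg _)
    _ = _ := by ring

/-- Minkowski's inequality for finite double sums. -/
lemma minkowski_sum_sum {α β : Type*} (s : Finset α) (t : Finset β) {q : ℝ} (hq : 1 ≤ q)
    (g : α → β → ℝ) (hg : ∀ a b, 0 ≤ g a b) :
    (∑ a ∈ s, (∑ b ∈ t, g a b) ^ q) ^ (1 / q) ≤ ∑ b ∈ t, (∑ a ∈ s, g a b ^ q) ^ (1 / q) := by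
  classical
  induction t using Finset.induction_on with
  | empty =>
    have : q ≠ 0 := by positivity
    simp [Real.zero_rpow this, Real.zero_rpow (inv_ne_zero this)]
  | insert b t hb ih =>
    simp only [Finset.sum_insert hb]
    refine (Real.Lp_add_le_of_nonneg s hq (fun a _ => hg a b)
      (fun a _ => Finset.sum_nonneg fun _ _ => hg _ _)).trans ?_
    gcongr

/-- Iterated cotype inequality for arrays with `m` indices and products of independent signs. -/
lemma iterated_cotype {Y : Type*} [NormedAddCommGroup Y] {q C : ℝ} (hq : 1 ≤ q) (hC0 : 0 ≤ C)
    (hC : ∀ (n : ℕ) (y : Fin n → Y), (∑ i, ‖y i‖ ^ q) ^ (1 / q) ≤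
        C * ((∑ ε : Fin n → ℤˣ, ‖∑ i, (ε i : ℤ) • y i‖) / 2 ^ n)) (N : ℕ) :
    ∀ (m : ℕ) (y : (Fin m → Fin N) → Y), (∑ i, ‖y i‖ ^ q) ^ (1 / q) ≤
      C ^ m * ((∑ ε : Fin m → Fin N → ℤˣ, ‖∑ i, ((∏ j, ε j (i j) : ℤˣ) : ℤ) • y i‖) /
        (2 ^ N) ^ m)
  | 0, y => by
    have : q ≠ 0 := by positivity
    simp [Real.rpow_rpow_inv (norm_nonneg _) this]
  | m + 1, y => by
    have ih := fun a => iterated_cotype hq hC0 hC N m (fun i => y (Fin.cons a i))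
    set F : Fin N → (Fin m → Fin N → ℤˣ) → Y :=
      fun a ε => ∑ i, ((∏ j, ε j (i j) : ℤˣ) : ℤ) • y (Fin.cons a i) with hF
    have hq0 : 0 < q := by linarith
    set D : ℝ := C ^ m / (2 ^ N) ^ m with hD
    have hD0 : 0 ≤ D := by positivity
    have ih' : ∀ a, ∑ i, ‖y (Fin.cons a i)‖ ^ q ≤ (∑ ε, D * ‖F a ε‖) ^ q := by
      intro a
      have h1 : 0 ≤ ∑ i, ‖y (Fin.cons a i)‖ ^ q := by positivity
      rw [← Real.rpow_inv_rpow h1 hq0.ne', ← one_div]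
      refine Real.rpow_le_rpow (by positivity) ((ih a).trans (le_of_eq ?_)) hq0.le
      rw [← Finset.mul_sum, hD]; ring
    calc (∑ i, ‖y i‖ ^ q) ^ (1 / q)
        = (∑ a, ∑ i : Fin m → Fin N, ‖y (Fin.cons a i)‖ ^ q) ^ (1 / q) := by
          rw [sum_fin_succ_pi]
      _ ≤ (∑ a, (∑ ε, D * ‖F a ε‖) ^ q) ^ (1 / q) := by
          gcongr with a
          exact ih' a
      -- Since the average is an L¹ one, Minkowski moves it outside the ℓ^q norm; cotype in the
      -- remaining index is then used for fixed ε.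
      _ ≤ ∑ ε, (∑ a, (D * ‖F a ε‖) ^ q) ^ (1 / q) :=
          minkowski_sum_sum _ _ hq _ fun _ _ => by positivity
      _ = ∑ ε, D * (∑ a, ‖F a ε‖ ^ q) ^ (1 / q) := by
          refine Finset.sum_congr rfl fun ε _ => ?_
          simp_rw [Real.mul_rpow hD0 (norm_nonneg _)]
          rw [← Finset.mul_sum, Real.mul_rpow (by positivity) (by positivity), one_div,
            Real.rpow_rpow_inv hD0 hq0.ne']
      _ ≤ ∑ ε, D * (C * ((∑ η : Fin N → ℤˣ, ‖∑ a, (η a : ℤ) • F a ε‖) / 2 ^ N)) := by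
          gcongr with ε
          exact hC N fun a => F a ε
      _ = _ := by
          have h2 : ∀ (η : Fin N → ℤˣ) ε, ∑ a, (η a : ℤ) • F a ε = ∑ i : Fin (m + 1) → Fin N,
              ((∏ j, (Fin.cons η ε : Fin (m + 1) → Fin N → ℤˣ) j (i j) : ℤˣ) : ℤ) • y i := by
            intro η ε
            rw [sum_fin_succ_pi]
            refine Finset.sum_congr rfl fun a _ => ?_
            rw [hF, Finset.smul_sum]
            refine Finset.sum_congr rfl fun i _ => ?_
            simp [Fin.prod_univ_succ, mul_smul]
          simp_rw [h2]
          rw [sum_fin_succ_pi, Finset.sum_comm, Finset.sum_div, Finset.mul_sum]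
          refine Finset.sum_congr rfl fun ε _ => ?_
          rw [hD, pow_succ, pow_succ]
          field_simp

end Cotype

/-! ### Uniform boundedness in several variables -/

section UniformBoundedness

variable {𝕜 : Type*} [RCLike 𝕜]

/-- Uniform boundedness principle for a family of functions of several variables, each of which is
a continuous seminorm in every variable of `J` separately. -/
lemma exists_bound_of_separately_seminorm {κ α : Type*} [DecidableEq κ] {X : κ → Type*}
    [∀ j, NormedAddCommGroup (X j)] [∀ j, NormedSpace 𝕜 (X j)] [∀ j, CompleteSpace (X j)]
    (Φ : α → (∀ j, X j) → ℝ) (J : Finset κ)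
    (hΦ : ∀ j ∈ J, ∀ a z, ∃ P : Seminorm 𝕜 (X j), Continuous P ∧
      ∀ v, P v = Φ a (Function.update z j v))
    (hb : ∀ z, ∃ C, ∀ a, Φ a z ≤ C) (z : ∀ j, X j) :
    ∃ C, ∀ a y, (∀ j ∈ J, ‖y j‖ ≤ 1) → (∀ j ∉ J, y j = z j) → Φ a y ≤ C := by
  induction J using Finset.induction_on generalizing z with
  | empty =>
    obtain ⟨C, hC⟩ := hb z
    refine ⟨C, fun a y _ hy => ?_⟩
    rw [show y = z from funext fun j => hy j (by simp)]
    exact hC a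
  | insert i J hi ih =>
    have ih := ih fun j hj => hΦ j (Finset.mem_insert_of_mem hj)
    choose P hPc hP using hΦ i (Finset.mem_insert_self i J)
    -- The new variable i is handled by a family of seminorms indexed by the parameter and all
    -- admissible values of the earlier variables. The induction hypothesis at `update z i v` bounds
    -- it at v, and completeness of `X i` makes its supremum continuous.
    let I := {s : α × (∀ j, X j) // (∀ j ∈ J, ‖s.2 j‖ ≤ 1) ∧ ∀ j ∉ J, s.2 j = z j}
    let Q : I → Seminorm 𝕜 (X i) := fun s => P s.1.1 s.1.2
    have hbdd : BddAbove (Set.range Q) := by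
      rw [Seminorm.bddAbove_range_iff]
      intro v
      obtain ⟨C, hC⟩ := ih (Function.update z i v)
      refine ⟨C, ?_⟩
      rintro _ ⟨s, rfl⟩
      simp only [Q, hP]
      refine hC _ _ (fun j hj => ?_) fun j hj => ?_
      · rw [Function.update_of_ne (by rintro rfl; exact hi hj)]
        exact s.2.1 j hj
      · by_cases h : j = i
        · subst h; simp
        · rw [Function.update_of_ne h, Function.update_of_ne h]
          exact s.2.2 j hj
    obtain ⟨C, hC0, hC⟩ := Seminorm.bound_of_continuous_normedSpace _
      (Seminorm.coe_iSup_eq hbdd ▸ Seminorm.continuous_iSup Q (fun s => hPc _ _) hbdd)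
    refine ⟨C, fun a y hy1 hy2 => ?_⟩
    have hy : y = Function.update (Function.update y i (z i)) i (y i) := by simp
    let s : I := ⟨(a, Function.update y i (z i)), fun j hj => by
        dsimp only
        rw [Function.update_of_ne (by rintro rfl; exact hi hj)]
        exact hy1 j (Finset.mem_insert_of_mem hj), fun j hj => by
        by_cases h : j = i
        · subst h; simp
        · simp only [Function.update_of_ne h]
          exact hy2 j (by simp [h, hj])⟩
    have h1 : Φ a y = Q s (y i) := by
      simp only [Q, hP, s]
      rw [← hy]
    rw [h1]
    calc Q s (y i) ≤ (⨆ s, Q s) (y i) := le_ciSup hbdd s (y i)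
      _ ≤ C * ‖y i‖ := hC _
      _ ≤ C * 1 := by gcongr; exact hy1 i (Finset.mem_insert_self i J)
      _ = C := mul_one C

/-- The seminorm `v ↦ (∑ₐ ‖u a v‖^r)^{1/r}`. -/
noncomputable def lpSeminorm {E Y : Type*} [NormedAddCommGroup E] [NormedSpace 𝕜 E]
    [NormedAddCommGroup Y] [NormedSpace 𝕜 Y] {N : ℕ} {r : ℝ} (hr : 1 ≤ r)
    (u : Fin N → E →ₗ[𝕜] Y) : Seminorm 𝕜 E :=
  Seminorm.of (fun v => (∑ a, ‖u a v‖ ^ r) ^ (1 / r))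
    (fun v w => by
      refine le_trans ?_ (Real.Lp_add_le_of_nonneg _ hr (fun _ _ => norm_nonneg _)
        (fun _ _ => norm_nonneg _))
      gcongr with a
      rw [map_add]
      exact norm_add_le _ _)
    (fun c v => by
      have hr0 : r ≠ 0 := by positivity
      simp only [map_smul, norm_smul]
      simp_rw [Real.mul_rpow (norm_nonneg c) (norm_nonneg _)]
      rw [← Finset.mul_sum, Real.mul_rpow (by positivity) (by positivity), one_div,
            Real.rpow_rpow_inv (norm_nonneg c) hr0])

lemma continuous_lpSeminorm {E Y : Type*} [NormedAddCommGroup E] [NormedSpace 𝕜 E]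
    [NormedAddCommGroup Y] [NormedSpace 𝕜 Y] {N : ℕ} {r : ℝ} (hr : 1 ≤ r)
    (u : Fin N → E →ₗ[𝕜] Y) (hu : ∀ a, Continuous (u a)) : Continuous (lpSeminorm hr u) := by
  change Continuous fun v => (∑ a, ‖u a v‖ ^ r) ^ (1 / r)
  refine Continuous.rpow_const ?_ fun _ => Or.inr (by positivity)
  refine continuous_finsetSum _ fun a _ => ?_
  exact (hu a).norm.rpow_const fun _ => Or.inr (by positivity)

end UniformBoundedness

/-! ### Weakly summable finite sequences -/

section Weak

variable {𝕜 : Type*} [RCLike 𝕜] {E : Type*} [NormedAddCommGroup E] [NormedSpace 𝕜 E]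

/-- A finite sequence with weak `ℓ^p`-norm at most `1`. -/
def IsWeaklyBounded (𝕜 : Type*) [RCLike 𝕜] {E : Type*} [NormedAddCommGroup E] [NormedSpace 𝕜 E]
    (p : ℝ) {N : ℕ} (x : Fin N → E) : Prop :=
  ∀ φ : StrongDual 𝕜 E, ‖φ‖ ≤ 1 → ∑ a, ‖φ (x a)‖ ^ p ≤ 1

/-- Extension of a finite sequence by zero. -/
def extendZero {N : ℕ} (x : Fin N → E) (i : ℕ) : E := if h : i < N then x ⟨i, h⟩ else 0

lemma tsum_extendZero {N : ℕ} (x : Fin N → E) (f : E → ℝ≥0∞) (hf : f 0 = 0) :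
    ∑' i, f (extendZero x i) = ∑ a, f (x a) := by
  rw [tsum_eq_sum (s := Finset.range N) fun i hi => by
    simp only [Finset.mem_range, not_lt] at hi
    simp [extendZero, hi.not_gt, hf]]
  rw [Finset.sum_range]
  exact Finset.sum_congr rfl fun a _ => by simp [extendZero]

lemma IsWeaklyBounded.weakLpNorm_extendZero_le {p : ℝ} (hp : 1 ≤ p) {N : ℕ} {x : Fin N → E}
    (hx : IsWeaklyBounded 𝕜 p x) : weakLpNorm 𝕜 p (extendZero x) ≤ 1 := by
  have hp0 : 0 < p := by linarith
  refine iSup₂_le fun φ hφ => ?_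
  rw [tsum_extendZero x (fun v => ‖φ v‖ₑ ^ p) (by simp [hp0])]
  refine ENNReal.rpow_le_one ?_ (by positivity)
  have := hx φ hφ
  rw [← ENNReal.ofReal_le_one] at this
  rw [ENNReal.ofReal_sum_of_nonneg (fun _ _ => by positivity)] at this
  simpa only [← ENNReal.ofReal_rpow_of_nonneg (norm_nonneg _) hp0.le, ofReal_norm] using this

lemma le_weakLpNorm (p : ℝ) (x : ℕ → E) {φ : StrongDual 𝕜 E} (hφ : ‖φ‖ ≤ 1) :
    (∑' i : ℕ, ‖φ (x i)‖ₑ ^ p) ^ (1 / p) ≤ weakLpNorm 𝕜 p x :=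
  le_iSup₂ (f := fun (φ : StrongDual 𝕜 E) (_ : ‖φ‖ ≤ 1) =>
    (∑' i : ℕ, ‖φ (x i)‖ₑ ^ p) ^ (1 / p)) φ hφ

lemma isWeaklyBounded_of_weakLpNorm_le {p : ℝ} (hp : 1 ≤ p) {x : ℕ → E}
    (hx : weakLpNorm 𝕜 p x ≤ 1) (N : ℕ) : IsWeaklyBounded 𝕜 p fun a : Fin N => x a := by
  have hp0 : 0 < p := by linarith
  intro φ hφ
  have h1 := (le_weakLpNorm p x hφ).trans hx
  rw [one_div, ENNReal.rpow_inv_le_iff hp0, ENNReal.one_rpow] at h1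
  rw [← ENNReal.ofReal_le_one, ENNReal.ofReal_sum_of_nonneg (fun _ _ => by positivity)]
  simp only [← ENNReal.ofReal_rpow_of_nonneg (norm_nonneg _) hp0.le, ofReal_norm]
  rw [← Finset.sum_range (fun i => ‖φ (x i)‖ₑ ^ p)]
  exact (ENNReal.sum_le_tsum _).trans h1

variable {Y : Type*} [NormedAddCommGroup Y] [NormedSpace 𝕜 Y]

/-- A summing map satisfies the summing inequality for finite sequences, in `ℝ`. -/
lemma IsSumming.exists_bound {r p : ℝ} (hr : 1 ≤ r) (hp : 1 ≤ p) {u : E →ₗ[𝕜] Y}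
    (hu : IsSumming r p u) : ∃ C : ℝ, ∀ (N : ℕ) (x : Fin N → E), IsWeaklyBounded 𝕜 p x →
      (∑ a, ‖u (x a)‖ ^ r) ^ (1 / r) ≤ C := by
  obtain ⟨C, -, hC⟩ := hu
  have hr0 : 0 < r := by linarith
  refine ⟨C, fun N x hx => ?_⟩
  have h := (hC (extendZero x)).trans (mul_le_mul_right (hx.weakLpNorm_extendZero_le hp) _)
  rw [tsum_extendZero x (fun v => ‖u v‖ₑ ^ r) (by simp [hr0]), mul_one] at h
  have h2 : (0 : ℝ) ≤ ∑ a, ‖u (x a)‖ ^ r := by positivity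
  rw [← ENNReal.ofReal_le_ofReal_iff C.coe_nonneg, ENNReal.ofReal_coe_nnreal,
    ← ENNReal.ofReal_rpow_of_nonneg h2 (by positivity),
    ENNReal.ofReal_sum_of_nonneg (fun _ _ => by positivity)]
  simpa only [← ENNReal.ofReal_rpow_of_nonneg (norm_nonneg _) hr0.le, ofReal_norm] using h

/-- A single vector of the unit ball is a weakly bounded sequence of length one, so the summing
constant bounds the operator norm. Separate continuity of T, needed for uniform boundedness, comes
from here. -/
lemma IsSumming.continuous {r p : ℝ} (hr : 1 ≤ r) (hp : 1 ≤ p) {u : E →ₗ[𝕜] Y}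
    (hu : IsSumming r p u) : Continuous u := by
  obtain ⟨C, hC⟩ := hu.exists_bound hr hp
  have hr0 : 0 < r := by linarith
  have h1 : ∀ v : E, ‖v‖ ≤ 1 → ‖u v‖ ≤ C := by
    intro v hv
    have := hC 1 (fun _ => v) fun φ hφ => by
      simp only [Finset.univ_unique, Finset.sum_const, Finset.card_singleton, one_smul]
      refine Real.rpow_le_one (norm_nonneg _) ?_ (by linarith)
      exact (φ.le_of_opNorm_le hφ v).trans (by simpa using hv)
    simpa [Real.rpow_rpow_inv (norm_nonneg _) hr0.ne'] using this
  refine AddMonoidHomClass.continuous_of_bound u C fun v => ?_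
  rcases eq_or_ne v 0 with rfl | hv
  · simp
  have hv' : ‖v‖ ≠ 0 := norm_ne_zero_iff.2 hv
  have h2 := h1 (((‖v‖⁻¹ : ℝ) : 𝕜) • v) (by simp [norm_smul, hv'])
  rw [map_smul, norm_smul] at h2
  simp only [RCLike.norm_ofReal, abs_inv, abs_norm] at h2
  rwa [inv_mul_le_iff₀ (by positivity), mul_comm] at h2

end Weak

/-! ### Uniform summing constants -/

section Multilinear

variable {𝕜 : Type*} [RCLike 𝕜] {m : ℕ} {X : Fin m → Type*} {Y : Type*}
    [∀ j, NormedAddCommGroup (X j)] [∀ j, NormedSpace 𝕜 (X j)] [∀ j, CompleteSpace (X j)]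
    [NormedAddCommGroup Y] [NormedSpace 𝕜 Y]

/-- The summing constant in the `k`-th coordinate is bounded on the unit balls of the others. -/
lemma exists_uniform_summing_bound (T : MultilinearMap 𝕜 X Y) {r p : Fin m → ℝ}
    (hr : ∀ k, 1 ≤ r k) (hp : ∀ k, 1 ≤ p k) (hT : ∀ k, IsSummingInCoord (r k) (p k) k T)
    (k : Fin m) : ∃ C : ℝ, 0 ≤ C ∧ ∀ (N : ℕ) (x : Fin N → X k), IsWeaklyBounded 𝕜 (p k) x →
      ∀ z : (∀ j, X j), (∀ j ≠ k, ‖z j‖ ≤ 1) →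
        ∑ a, ‖T (Function.update z k (x a))‖ ^ r k ≤ C ^ r k := by
  -- The parameters are all finite weakly bounded test sequences in slot k. Summability in slot k
  -- gives the pointwise bounds; summability in each other slot gives continuity there.
  let α := (N : ℕ) × {x : Fin N → X k // IsWeaklyBounded 𝕜 (p k) x}
  let Φ : α → (∀ j, X j) → ℝ := fun s z =>
    (∑ a, ‖T (Function.update z k (s.2.1 a))‖ ^ r k) ^ (1 / r k)
  have hr0 : 0 < r k := by linarith [hr k]
  obtain ⟨C, hC⟩ := exists_bound_of_separately_seminorm (𝕜 := 𝕜) Φ (Finset.univ.erase k)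
    (fun j hj s z => by
      have hjk : j ≠ k := Finset.ne_of_mem_erase hj
      refine ⟨lpSeminorm (hr k) fun a => T.toLinearMap (Function.update z k (s.2.1 a)) j,
        continuous_lpSeminorm _ _ fun a => (hT j _).continuous (hr j) (hp j), fun v => ?_⟩
      change (∑ a, ‖T (Function.update (Function.update z k (s.2.1 a)) j v)‖ ^ r k) ^ (1 / r k) = _
      simp only [Φ]
      simp_rw [Function.update_comm hjk])
    (fun z => by
      obtain ⟨C, hC⟩ := (hT k z).exists_bound (hr k) (hp k)
      exact ⟨C, fun s => hC s.1 s.2.1 s.2.2⟩) 0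
  refine ⟨|C|, abs_nonneg C, fun N x hx z hz => ?_⟩
  have h := hC ⟨N, x, hx⟩ (Function.update z k 0)
    (fun j hj => by
      rw [Function.update_of_ne (Finset.ne_of_mem_erase hj)]
      exact hz j (Finset.ne_of_mem_erase hj))
    (fun j hj => by
      obtain rfl : j = k := by simpa using hj
      simp)
  simp only [Φ, Function.update_idem] at h
  have h2 : (0 : ℝ) ≤ ∑ a, ‖T (Function.update z k (x a))‖ ^ r k := by positivity
  rw [← Real.rpow_inv_rpow h2 hr0.ne', ← one_div]
  exact Real.rpow_le_rpow (by positivity) (h.trans (le_abs_self C)) hr0.le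

end Multilinear

/-! ### Hölder inequalities and absorption -/

section FiniteHolder

/-- Hölder's inequality for finite sums of products of finitely many factors. -/
lemma sum_prod_rpow_le {α κ : Type*} (s : Finset α) (t : Finset κ) (e : κ → ℝ) (f : κ → α → ℝ)
    (hf : ∀ k i, 0 ≤ f k i) (he : ∀ k ∈ t, 0 ≤ e k) (he1 : ∑ k ∈ t, e k = 1) :
    ∑ i ∈ s, ∏ k ∈ t, f k i ^ e k ≤ ∏ k ∈ t, (∑ i ∈ s, f k i) ^ e k := by
  set F : κ → ℝ := fun k => ∑ i ∈ s, f k i with hF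
  have hF0 : ∀ k, 0 ≤ F k := fun k => Finset.sum_nonneg fun i _ => hf k i
  -- Weighted AM–GM for the normalised factors f k i / F k. If F k = 0, every f k i with i in s
  -- vanishes, so the division by zero is harmless.
  have h1 : ∀ i ∈ s, ∏ k ∈ t, f k i ^ e k ≤
      (∑ k ∈ t, e k * (f k i / F k)) * ∏ k ∈ t, F k ^ e k := by
    intro i hi
    have h2 : ∏ k ∈ t, f k i ^ e k = (∏ k ∈ t, (f k i / F k) ^ e k) * ∏ k ∈ t, F k ^ e k := by
      rw [← Finset.prod_mul_distrib]
      refine Finset.prod_congr rfl fun k _ => ?_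
      rw [← Real.mul_rpow (div_nonneg (hf k i) (hF0 k)) (hF0 k)]
      congr 1
      refine (div_mul_cancel_of_imp fun h => ?_).symm
      exact (Finset.sum_eq_zero_iff_of_nonneg fun i _ => hf k i).1 h i hi
    rw [h2]
    refine mul_le_mul_of_nonneg_right ?_ (Finset.prod_nonneg fun k _ => Real.rpow_nonneg (hF0 k) _)
    exact Real.geom_mean_le_arith_mean_weighted t e _ he he1
      fun k _ => div_nonneg (hf k i) (hF0 k)
  refine (Finset.sum_le_sum h1).trans ?_
  rw [← Finset.sum_mul]
  refine mul_le_of_le_one_left (Finset.prod_nonneg fun k _ => Real.rpow_nonneg (hF0 k) _) ?_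
  rw [Finset.sum_comm, ← he1]
  refine Finset.sum_le_sum fun k hk => ?_
  rw [← Finset.mul_sum, ← Finset.sum_div]
  exact mul_le_of_le_one_right (he k hk) (div_self_le_one _)

lemma sum_rpow_mul_rpow_le {α : Type*} (s : Finset α) {c d : ℝ} (hc : 0 ≤ c) (hd : 0 ≤ d)
    (hcd : c + d = 1) (f g : α → ℝ) (hf : ∀ i, 0 ≤ f i) (hg : ∀ i, 0 ≤ g i) :
    ∑ i ∈ s, f i ^ c * g i ^ d ≤ (∑ i ∈ s, f i) ^ c * (∑ i ∈ s, g i) ^ d := by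
  have := sum_prod_rpow_le s Finset.univ ![c, d] ![f, g]
    (fun k i => by fin_cases k <;> simp [hf, hg]) (fun k _ => by fin_cases k <;> simp [hc, hd])
    (by simp [hcd])
  simpa [Fin.prod_univ_two] using this

lemma sum_rpow_le_rpow_sum {α : Type*} (s : Finset α) {c : ℝ} (hc : 1 ≤ c) (f : α → ℝ)
    (hf : ∀ i, 0 ≤ f i) : ∑ i ∈ s, f i ^ c ≤ (∑ i ∈ s, f i) ^ c := by
  classical
  induction s using Finset.induction_on with
  | empty => simp [Real.zero_rpow (show c ≠ 0 by positivity)]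
  | insert a s ha ih =>
    rw [Finset.sum_insert ha, Finset.sum_insert ha]
    exact (add_le_add_right ih _).trans
      (Real.add_rpow_le_rpow_add (hf a) (Finset.sum_nonneg fun i _ => hf i) hc)

lemma prod_rpow_le_of_le {κ : Type*} (t : Finset κ) {e x : κ → ℝ} {d : κ → ℝ} {M : ℝ} (hM : 0 < M)
    (he : ∀ k ∈ t, 0 ≤ e k) (hx : ∀ k ∈ t, 0 ≤ x k) (h : ∀ k ∈ t, x k ≤ M ^ d k) :
    ∏ k ∈ t, x k ^ e k ≤ M ^ ∑ k ∈ t, d k * e k := by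
  rw [Real.rpow_sum_of_pos hM]
  refine Finset.prod_le_prod (fun k hk => Real.rpow_nonneg (hx k hk) _) fun k hk => ?_
  rw [Real.rpow_mul hM.le]
  exact Real.rpow_le_rpow (hx k hk) (h k hk) (he k hk)

/-- Closes each self-improving estimate below. Absorbing M is legitimate because the arrays are
finite, so M is a real number from the start. -/
lemma le_one_of_le_rpow {M e : ℝ} (he : e < 1) (h : M ≤ M ^ e) : M ≤ 1 := by
  by_contra! hM
  have := Real.rpow_lt_rpow_of_exponent_lt hM he
  rw [Real.rpow_one] at this
  linarith

end FiniteHolder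

/-! ### Weighted mixed norms of nonnegative arrays -/

section Array

variable {κ I : Type*} [Fintype κ] [DecidableEq κ] [Fintype I] [DecidableEq I]

/-- The `j`-th marginal of an array. -/
def marginal (b : (κ → I) → ℝ) (j : κ) (a : I) : ℝ := ∑ i with i j = a, b i

lemma marginal_nonneg {b : (κ → I) → ℝ} (hb : ∀ i, 0 ≤ b i) (j : κ) (a : I) :
    0 ≤ marginal b j a := Finset.sum_nonneg fun i _ => hb i

lemma le_marginal {b : (κ → I) → ℝ} (hb : ∀ i, 0 ≤ b i) (j : κ) (i : κ → I) :
    b i ≤ marginal b j (i j) :=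
  Finset.single_le_sum (f := b) (fun i _ => hb i) (by simp)

lemma sum_marginal_mul (b : (κ → I) → ℝ) (j : κ) (f : I → ℝ) :
    ∑ a, marginal b j a * f a = ∑ i, b i * f (i j) := by
  rw [← Finset.sum_fiberwise Finset.univ (fun i : κ → I => i j)]
  refine Finset.sum_congr rfl fun a _ => ?_
  rw [marginal, Finset.sum_mul]
  refine Finset.sum_congr rfl fun i hi => ?_
  rw [(Finset.mem_filter.1 hi).2]

lemma sum_marginal (b : (κ → I) → ℝ) (j : κ) : ∑ a, marginal b j a = ∑ i, b i := by
  simpa using sum_marginal_mul b j 1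

/-- One factor of s^δ = s · s^{δ-1} is expanded over its fibre. Mixed norms in different coordinates
thus become sums over the same index set, where Hölder can combine them. -/
lemma sum_marginal_rpow (b : (κ → I) → ℝ) (hb : ∀ i, 0 ≤ b i) (j : κ) {δ : ℝ} (hδ : δ ≠ 0) :
    ∑ a, marginal b j a ^ δ = ∑ i, b i * marginal b j (i j) ^ (δ - 1) := by
  rw [← sum_marginal_mul b j fun a => marginal b j a ^ (δ - 1)]
  refine Finset.sum_congr rfl fun a _ => ?_
  rcases (marginal_nonneg hb j a).eq_or_lt with h | h
  · rw [← h]; simp [hδ]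
  · rw [Real.rpow_sub_one h.ne']; field_simp

/-- For all weights `w j` of total mass at most one, attached to the coordinates other than `k`, the
weighted array has finite mixed norm. -/
def WeightedMixedBound (τ ρ : κ → ℝ) (b : (κ → I) → ℝ) : Prop :=
  ∀ (k : κ) (w : κ → I → ℝ), (∀ j a, 0 ≤ w j a) → (∀ j, ∑ a, w j a ≤ 1) →
    ∑ a, (marginal (fun i => (∏ j ∈ Finset.univ.erase k, w j (i j) ^ τ j) * b i) k a) ^ ρ k ≤ 1

/-- The self-weighted inequality: use powers of the marginals of the array as weights. -/
lemma WeightedMixedBound.self_weighted {τ ρ : κ → ℝ} {b : (κ → I) → ℝ}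
    (H : WeightedMixedBound τ ρ b) (hb : ∀ i, 0 ≤ b i) {δ M : ℝ} (hM : 0 < M)
    (hN : ∀ j, ∑ a, marginal b j a ^ δ ≤ M) (k : κ) (hρ0 : 0 < ρ k) (hρ1 : ρ k ≤ 1)
    (hrel : ρ k * ∑ j ∈ Finset.univ.erase k, τ j = 1 - ρ k / δ) :
    ∑ i, b i * (marginal b k (i k) ^ (ρ k - 1) *
      ∏ j ∈ Finset.univ.erase k, marginal b j (i j) ^ (δ * τ j * ρ k)) ≤ M ^ (1 - ρ k / δ) := by
  set s := marginal b with hs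
  have hs0 : ∀ j a, 0 ≤ s j a := marginal_nonneg hb
  have hw0 : ∀ j a, 0 ≤ s j a ^ δ / M := fun j a => div_nonneg (Real.rpow_nonneg (hs0 j a) _) hM.le
  have h := H k (fun j a => s j a ^ δ / M) hw0
    (fun j => by rw [← Finset.sum_div]; exact (div_le_one hM).2 (hN j))
  set W : (κ → I) → ℝ := fun i => ∏ j ∈ Finset.univ.erase k, (s j (i j) ^ δ / M) ^ τ j with hW
  have hW0 : ∀ i, 0 ≤ W i := fun i => Finset.prod_nonneg fun j _ => Real.rpow_nonneg (hw0 _ _) _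
  have hWρ : ∀ i, W i ^ ρ k =
      (∏ j ∈ Finset.univ.erase k, s j (i j) ^ (δ * τ j * ρ k)) / M ^ (1 - ρ k / δ) := by
    intro i
    rw [hW, ← Real.finsetProd_rpow _ _ fun j _ => Real.rpow_nonneg (hw0 _ _) _, ← hrel,
      Finset.mul_sum, Real.rpow_sum_of_pos hM, ← Finset.prod_div_distrib]
    refine Finset.prod_congr rfl fun j _ => ?_
    rw [← Real.rpow_mul (hw0 _ _), Real.div_rpow (Real.rpow_nonneg (hs0 _ _) _) hM.le,
      ← Real.rpow_mul (hs0 _ _), mul_comm (ρ k), mul_assoc]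
  -- On a fibre, Hölder with exponents ρ k and 1 - ρ k gives ∑ (Wb)^ρ b^{1-ρ} ≤ (∑ Wb)^ρ s^{1-ρ};
  -- the factor s^{ρ-1} cancels the last power.
  have h1 : ∀ a, ∑ i with i k = a, b i * (s k (i k) ^ (ρ k - 1) * W i ^ ρ k) ≤
      marginal (fun i => W i * b i) k a ^ ρ k := by
    intro a
    rcases (hs0 k a).eq_or_lt with h0 | h0
    · rw [Finset.sum_eq_zero]
      · exact Real.rpow_nonneg (marginal_nonneg (fun i => mul_nonneg (hW0 i) (hb i)) _ _) _
      · intro i hi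
        rw [(Finset.sum_eq_zero_iff_of_nonneg fun i _ => hb i).1 h0.symm i hi, zero_mul]
    have h2 := sum_rpow_mul_rpow_le (Finset.univ.filter fun i : κ → I => i k = a) hρ0.le
      (sub_nonneg.2 hρ1) (by ring) (fun i => W i * b i) b (fun i => mul_nonneg (hW0 i) (hb i)) hb
    have h3 : ∑ i with i k = a, b i * (s k (i k) ^ (ρ k - 1) * W i ^ ρ k) =
        s k a ^ (ρ k - 1) * ∑ i with i k = a, (W i * b i) ^ ρ k * b i ^ (1 - ρ k) := by
      rw [Finset.mul_sum]
      refine Finset.sum_congr rfl fun i hi => ?_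
      rw [(Finset.mem_filter.1 hi).2, Real.mul_rpow (hW0 i) (hb i)]
      rcases (hb i).eq_or_lt with h4 | h4
      · rw [← h4, Real.zero_rpow hρ0.ne']; ring
      · rw [mul_assoc (W i ^ ρ k), ← Real.rpow_add h4, add_sub_cancel, Real.rpow_one]; ring
    rw [h3]
    refine (mul_le_mul_of_nonneg_left h2 (Real.rpow_nonneg h0.le _)).trans (le_of_eq ?_)
    change s k a ^ (ρ k - 1) * (_ * s k a ^ (1 - ρ k)) = _
    rw [mul_left_comm, ← Real.rpow_add h0, show ρ k - 1 + (1 - ρ k) = 0 by ring, Real.rpow_zero,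
      mul_one]
    rfl
  have h5 := (Finset.sum_le_sum fun a (_ : a ∈ Finset.univ) => h1 a).trans h
  rw [Finset.sum_fiberwise] at h5
  simp_rw [hWρ, ← mul_div_assoc] at h5
  rwa [← Finset.sum_div, div_le_one (Real.rpow_pos_of_pos hM _)] at h5

/-- Mixed-norm bound below the critical exponent. -/
lemma WeightedMixedBound.sum_marginal_rpow_le {τ ρ : κ → ℝ} {b : (κ → I) → ℝ}
    (H : WeightedMixedBound τ ρ b) (hb : ∀ i, 0 ≤ b i) {δ : ℝ} (hδ : 0 < δ) (hδ1 : δ < 1)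
    (hτ : ∀ k, 0 ≤ τ k) (hρ0 : ∀ k, 0 < ρ k)
    (hrel : ∀ k, ρ k * ∑ j ∈ Finset.univ.erase k, τ j = 1 - ρ k / δ) (l : κ) :
    ∑ a, marginal b l a ^ δ ≤ 1 := by
  have hs0 : ∀ j a, 0 ≤ marginal b j a := marginal_nonneg hb
  obtain ⟨k, -, hk⟩ := Finset.exists_max_image Finset.univ
    (fun j => ∑ a, marginal b j a ^ δ) ⟨l, Finset.mem_univ l⟩
  refine (hk l (Finset.mem_univ l)).trans ?_
  set M := ∑ a, marginal b k a ^ δ with hMdef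
  rcases le_or_gt M 0 with hM | hM
  · linarith
  have hρδ : ρ k ≤ δ := by
    have : 0 ≤ ρ k * ∑ j ∈ Finset.univ.erase k, τ j :=
      mul_nonneg (hρ0 k).le (Finset.sum_nonneg fun j _ => hτ j)
    rw [hrel, sub_nonneg, div_le_one hδ] at this
    exact this
  have hρ1 : 0 < 1 - ρ k := by linarith
  have star := H.self_weighted hb hM (fun j => hk j (Finset.mem_univ j)) k (hρ0 k) (by linarith)
    (hrel k)
  set c : ℝ := (1 - δ) / (1 - ρ k) with hc
  have hc0 : 0 < c := div_pos (by linarith) hρ1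
  set A : (κ → I) → ℝ := fun i => b i * (marginal b k (i k) ^ (ρ k - 1) *
      ∏ j ∈ Finset.univ.erase k, marginal b j (i j) ^ (δ * τ j * ρ k)) with hA
  have hA0 : ∀ i, 0 ≤ A i := fun i => mul_nonneg (hb i) (mul_nonneg (Real.rpow_nonneg (hs0 _ _) _)
    (Finset.prod_nonneg fun j _ => Real.rpow_nonneg (hs0 _ _) _))
  set f : κ → (κ → I) → ℝ := fun j i =>
    if j = k then A i else b i * marginal b j (i j) ^ (δ - 1) with hf
  -- In ∏ f_j^{e_j} the powers of the marginals j ≠ k must cancel and that of the k-th must be δ -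
  -- 1. This determines the exponents; `hrel` makes them add up to 1.
  set e : κ → ℝ := fun j => if j = k then c else δ * τ j * ρ k / (1 - ρ k) with he
  have hf0 : ∀ j i, 0 ≤ f j i := by
    intro j i
    simp only [hf]
    split_ifs
    · exact hA0 i
    · exact mul_nonneg (hb i) (Real.rpow_nonneg (hs0 _ _) _)
  have he0 : ∀ j, 0 ≤ e j := by
    intro j
    simp only [he]
    split_ifs
    · exact hc0.le
    · exact div_nonneg (mul_nonneg (mul_nonneg hδ.le (hτ j)) (hρ0 k).le) hρ1.le
  have hek : ∑ j ∈ Finset.univ.erase k, e j = (δ - ρ k) / (1 - ρ k) := by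
    calc ∑ j ∈ Finset.univ.erase k, e j
        = ∑ j ∈ Finset.univ.erase k, δ / (1 - ρ k) * (ρ k * τ j) :=
          Finset.sum_congr rfl fun j hj => by
            simp only [he, Finset.ne_of_mem_erase hj, if_false]; ring
      _ = (δ - ρ k) / (1 - ρ k) := by
          rw [← Finset.mul_sum, ← Finset.mul_sum, hrel]; field_simp
  have he1 : ∑ j, e j = 1 := by
    rw [← Finset.add_sum_erase _ _ (Finset.mem_univ k), hek]
    simp only [he, if_true, hc]
    field_simp
    ring
  have hpt : ∀ i, b i * marginal b k (i k) ^ (δ - 1) ≤ ∏ j, f j i ^ e j := by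
    intro i
    rcases (hb i).eq_or_lt with h0 | h0
    · rw [← h0, zero_mul]
      exact Finset.prod_nonneg fun j _ => Real.rpow_nonneg (hf0 _ _) _
    refine le_of_eq ?_
    have hs : ∀ j, 0 < marginal b j (i j) := fun j => h0.trans_le (le_marginal hb j i)
    -- In logarithmic coordinates the identity between products of powers becomes linear.
    obtain ⟨σ, hσ⟩ : ∃ σ : κ → ℝ, ∀ j, marginal b j (i j) = Real.exp (σ j) :=
      ⟨_, fun j => (Real.exp_log (hs j)).symm⟩
    obtain ⟨β, hβ⟩ : ∃ β, b i = Real.exp β := ⟨_, (Real.exp_log h0).symm⟩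
    have hprod : ∏ j ∈ Finset.univ.erase k, f j i ^ e j =
        ∏ j ∈ Finset.univ.erase k, (b i * marginal b j (i j) ^ (δ - 1)) ^ e j :=
      Finset.prod_congr rfl fun j hj => by simp only [hf, Finset.ne_of_mem_erase hj, if_false]
    rw [← Finset.mul_prod_erase _ _ (Finset.mem_univ k), hprod]
    simp only [hf, if_true, hA, hσ, hβ, ← Real.exp_mul, ← Real.exp_add, ← Real.exp_sum]
    congr 1
    have h2 : ∑ j ∈ Finset.univ.erase k, (β + σ j * (δ - 1)) * e j = β * (1 - c) -
        (∑ j ∈ Finset.univ.erase k, σ j * (δ * τ j * ρ k)) * c := by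
      rw [Finset.sum_mul, show 1 - c = ∑ j ∈ Finset.univ.erase k, e j by
        rw [hek, hc]; field_simp; ring, Finset.mul_sum, ← Finset.sum_sub_distrib]
      refine Finset.sum_congr rfl fun j hj => ?_
      simp only [he, Finset.ne_of_mem_erase hj, if_false, hc]
      field_simp
      ring
    rw [h2]
    simp only [he, if_true]
    have h3 : (ρ k - 1) * c = δ - 1 := by rw [hc]; field_simp; ring
    linear_combination -σ k * h3
  have h1 : M ≤ M ^ ∑ j, (if j = k then 1 - ρ k / δ else 1) * e j := by
    calc M = ∑ i, b i * marginal b k (i k) ^ (δ - 1) := sum_marginal_rpow b hb k hδ.ne'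
      _ ≤ ∑ i, ∏ j, f j i ^ e j := Finset.sum_le_sum fun i _ => hpt i
      _ ≤ ∏ j, (∑ i, f j i) ^ e j := sum_prod_rpow_le _ _ _ _ hf0 (fun j _ => he0 j) he1
      _ ≤ _ := prod_rpow_le_of_le _ hM (fun j _ => he0 j)
          (fun j _ => Finset.sum_nonneg fun i _ => hf0 j i) fun j _ => by
            simp only [hf]
            split_ifs with hj
            · exact star
            · rw [Real.rpow_one, ← sum_marginal_rpow b hb j hδ.ne']
              exact hk j (Finset.mem_univ j)
  refine le_one_of_le_rpow ?_ h1
  have h2 : ∑ j, (if j = k then 1 - ρ k / δ else 1) * e j = 1 - ρ k / δ * c := by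
    have : ∀ j, (if j = k then 1 - ρ k / δ else 1) * e j =
        e j - (if j = k then ρ k / δ * c else 0) := by
      intro j
      simp only [he]
      split_ifs <;> ring
    simp_rw [this]
    rw [Finset.sum_sub_distrib, he1]
    simp
  rw [h2]
  have : 0 < ρ k / δ * c := mul_pos (div_pos (hρ0 k) hδ) hc0
  linarith

/-- Blei's interpolation of mixed norms: if all mixed `(δ, 1)`-norms of an array are at most one,
so is its `σ`-norm, where `1/σ` is the mean of `1/δ` and of `card κ - 1` ones. -/
lemma sum_rpow_le_one_of_mixed [Nonempty κ] {b : (κ → I) → ℝ} (hb : ∀ i, 0 ≤ b i) {δ σ : ℝ}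
    (hδ : 0 < δ) (hδ1 : δ < 1) (hN : ∀ k, ∑ a, marginal b k a ^ δ ≤ 1)
    (hσ : 1 / σ = ((Fintype.card κ : ℝ) - 1) / Fintype.card κ + 1 / (δ * Fintype.card κ)) :
    ∑ i, b i ^ σ ≤ 1 := by
  set m : ℝ := (Fintype.card κ : ℝ) with hm
  have hm1 : (1 : ℝ) ≤ m := by rw [hm]; exact_mod_cast Fintype.card_pos
  have hm0 : 0 < m := by linarith
  have hs0 : ∀ j a, 0 ≤ marginal b j a := marginal_nonneg hb
  have hinv : 1 / σ - 1 = (1 - δ) / (δ * m) := by rw [hσ]; field_simp; ring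
  have hinv0 : 0 < (1 - δ) / (δ * m) := div_pos (by linarith) (by positivity)
  have hσ0 : 0 < σ := by
    by_contra! h
    have : 1 / σ ≤ 0 := div_nonpos_of_nonneg_of_nonpos zero_le_one h
    linarith
  have hσ1 : σ < 1 := by
    have : 1 < 1 / σ := by linarith
    rwa [lt_div_iff₀ hσ0, one_mul] at this
  set c : ℝ := (1 - δ) / m with hc
  have hcσ : c * σ = δ * (1 - σ) := by
    have : 1 - σ = σ * ((1 - δ) / (δ * m)) := by rw [← hinv]; field_simp
    rw [this, hc]; field_simp
  -- f is the geometric mean of the summands of the m mixed norms, so ∑ f ≤ 1 by Hölder, while ∑ g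
  -- factorises. The value of σ is the one for which the marginals cancel in f^σ g^{1-σ}, leaving
  -- b^σ.
  set f : (κ → I) → ℝ := fun i => ∏ k, (b i * marginal b k (i k) ^ (δ - 1)) ^ (1 / m) with hf
  set g : (κ → I) → ℝ := fun i => ∏ k, marginal b k (i k) ^ δ with hg
  have hf0 : ∀ i, 0 ≤ f i := fun i => Finset.prod_nonneg fun k _ =>
    Real.rpow_nonneg (mul_nonneg (hb i) (Real.rpow_nonneg (hs0 _ _) _)) _
  have hg0 : ∀ i, 0 ≤ g i := fun i => Finset.prod_nonneg fun k _ => Real.rpow_nonneg (hs0 _ _) _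
  have hsum1 : ∑ _k : κ, 1 / m = 1 := by
    rw [Finset.sum_const, Finset.card_univ, nsmul_eq_mul, ← hm]; field_simp
  have hfsum : ∑ i, f i ≤ 1 := by
    refine (sum_prod_rpow_le _ _ _ _ (fun k i => mul_nonneg (hb i) (Real.rpow_nonneg (hs0 _ _) _))
      (fun k _ => by positivity) hsum1).trans ?_
    refine Finset.prod_le_one (fun k _ => Real.rpow_nonneg (Finset.sum_nonneg fun i _ =>
      mul_nonneg (hb i) (Real.rpow_nonneg (hs0 _ _) _)) _) fun k _ => ?_
    rw [← sum_marginal_rpow b hb k hδ.ne']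
    exact Real.rpow_le_one (Finset.sum_nonneg fun a _ => Real.rpow_nonneg (hs0 _ _) _) (hN k)
      (by positivity)
  have hgsum : ∑ i, g i ≤ 1 := by
    have : ∑ i, g i = ∏ k, ∑ a, marginal b k a ^ δ := by
      rw [Finset.prod_univ_sum, Fintype.piFinset_univ]
    rw [this]
    exact Finset.prod_le_one (fun k _ => Finset.sum_nonneg fun a _ => Real.rpow_nonneg (hs0 _ _) _)
      fun k _ => hN k
  have hpt : ∀ i, b i ^ σ ≤ f i ^ σ * g i ^ (1 - σ) := by
    intro i
    rcases (hb i).eq_or_lt with h0 | h0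
    · rw [← h0, Real.zero_rpow hσ0.ne']
      exact mul_nonneg (Real.rpow_nonneg (hf0 i) _) (Real.rpow_nonneg (hg0 i) _)
    refine le_of_eq ?_
    have hs : ∀ j, 0 < marginal b j (i j) := fun j => h0.trans_le (le_marginal hb j i)
    obtain ⟨t, ht⟩ : ∃ t : κ → ℝ, ∀ j, marginal b j (i j) = Real.exp (t j) :=
      ⟨_, fun j => (Real.exp_log (hs j)).symm⟩
    obtain ⟨β, hβ⟩ : ∃ β, b i = Real.exp β := ⟨_, (Real.exp_log h0).symm⟩
    simp only [hf, hg, ht, hβ, ← Real.exp_mul, ← Real.exp_add, ← Real.exp_sum]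
    congr 1
    have h2 : ∑ k, (β + t k * (δ - 1)) * (1 / m) = β - (∑ k, t k) * c := by
      have h3 : ∀ k, (β + t k * (δ - 1)) * (1 / m) = β * (1 / m) - t k * c := fun k => by
        rw [hc]; ring
      simp_rw [h3]
      rw [Finset.sum_sub_distrib, ← Finset.mul_sum, hsum1, mul_one, ← Finset.sum_mul]
    rw [h2, ← Finset.sum_mul]
    linear_combination (∑ k, t k) * hcσ
  calc ∑ i, b i ^ σ ≤ ∑ i, f i ^ σ * g i ^ (1 - σ) := Finset.sum_le_sum fun i _ => hpt i
    _ ≤ (∑ i, f i) ^ σ * (∑ i, g i) ^ (1 - σ) :=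
        sum_rpow_mul_rpow_le _ hσ0.le (by linarith) (by ring) f g hf0 hg0
    _ ≤ 1 := mul_le_one₀ (Real.rpow_le_one (Finset.sum_nonneg fun i _ => hf0 i) hfsum hσ0.le)
        (Real.rpow_nonneg (Finset.sum_nonneg fun i _ => hg0 i) _)
        (Real.rpow_le_one (Finset.sum_nonneg fun i _ => hg0 i) hgsum (by linarith))

/-- Bound for the total mass of an array at the critical exponent. -/
lemma WeightedMixedBound.sum_le_one [Nonempty κ] {τ ρ : κ → ℝ} {b : (κ → I) → ℝ}
    (H : WeightedMixedBound τ ρ b) (hb : ∀ i, 0 ≤ b i) (hτ : ∀ k, 0 ≤ τ k) (hρ0 : ∀ k, 0 < ρ k)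
    (hρ1 : ∀ k, ρ k < 1) (hrel : ∀ k, ρ k * ∑ j ∈ Finset.univ.erase k, τ j = 1 - ρ k) :
    ∑ i, b i ≤ 1 := by
  have hs0 : ∀ j a, 0 ≤ marginal b j a := marginal_nonneg hb
  set M := ∑ i, b i with hMdef
  rcases le_or_gt M 0 with hM | hM
  · linarith
  set U := ∑ j, τ j with hU
  have hrel' : ∀ k, ρ k - 1 - ρ k * τ k = - (ρ k * U) := by
    intro k
    have h1 := hrel k
    rw [← Finset.add_sum_erase _ _ (Finset.mem_univ k)] at hU
    rw [hU]
    linear_combination h1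
  set Z := ∑ k, τ k / ρ k with hZ
  have hZ0 : 0 < Z := by
    obtain ⟨k⟩ := ‹Nonempty κ›
    have h1 : 0 < ρ k * ∑ j ∈ Finset.univ.erase k, τ j := by rw [hrel]; linarith [hρ1 k]
    have h2 : 0 < ∑ j ∈ Finset.univ.erase k, τ j := pos_of_mul_pos_right h1 (hρ0 k).le
    obtain ⟨j, -, hj⟩ := Finset.exists_lt_of_sum_lt
      (show ∑ j ∈ Finset.univ.erase k, (0 : ℝ) < ∑ j ∈ Finset.univ.erase k, τ j by simpa using h2)
    exact Finset.sum_pos' (fun k _ => div_nonneg (hτ k) (hρ0 k).le)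
      ⟨j, Finset.mem_univ j, div_pos hj (hρ0 j)⟩
  -- At δ = 1 the gain 1 - e of the subcritical argument degenerates to 0, so the self-weighted
  -- inequalities for all k are combined. With these exponents every marginal cancels, and the gain
  -- is U / Z.
  set e : κ → ℝ := fun k => τ k / ρ k / Z with he
  have he0 : ∀ k, 0 ≤ e k := fun k => div_nonneg (div_nonneg (hτ k) (hρ0 k).le) hZ0.le
  have he1 : ∑ k, e k = 1 := by rw [he, ← Finset.sum_div]; exact div_self hZ0.ne'
  have heρ : ∀ k, e k * ρ k = τ k / Z := by
    intro k
    have := (hρ0 k).ne'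
    simp only [he]; field_simp
  set f : κ → (κ → I) → ℝ := fun k i => b i * (marginal b k (i k) ^ (ρ k - 1) *
      ∏ j ∈ Finset.univ.erase k, marginal b j (i j) ^ (1 * τ j * ρ k)) with hf
  have hf0 : ∀ k i, 0 ≤ f k i := fun k i => mul_nonneg (hb i)
    (mul_nonneg (Real.rpow_nonneg (hs0 _ _) _)
    (Finset.prod_nonneg fun j _ => Real.rpow_nonneg (hs0 _ _) _))
  have hpt : ∀ i, b i ≤ ∏ k, f k i ^ e k := by
    intro i
    rcases (hb i).eq_or_lt with h0 | h0
    · rw [← h0]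
      exact Finset.prod_nonneg fun j _ => Real.rpow_nonneg (hf0 _ _) _
    refine le_of_eq ?_
    have hs : ∀ j, 0 < marginal b j (i j) := fun j => h0.trans_le (le_marginal hb j i)
    obtain ⟨t, ht⟩ : ∃ t : κ → ℝ, ∀ j, marginal b j (i j) = Real.exp (t j) :=
      ⟨_, fun j => (Real.exp_log (hs j)).symm⟩
    obtain ⟨β, hβ⟩ : ∃ β, b i = Real.exp β := ⟨_, (Real.exp_log h0).symm⟩
    simp only [hf, ht, hβ, ← Real.exp_mul, ← Real.exp_add, ← Real.exp_sum]
    congr 1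
    set A := ∑ j, t j * τ j with hA
    have h2 : ∀ k, (β + (t k * (ρ k - 1) + ∑ j ∈ Finset.univ.erase k, t j * (1 * τ j * ρ k))) * e k
        = β * e k + (A / Z) * τ k - (U / Z) * (t k * τ k) := by
      intro k
      have h3 : ∑ j ∈ Finset.univ.erase k, t j * (1 * τ j * ρ k) = (A - t k * τ k) * ρ k := by
        rw [hA, ← Finset.add_sum_erase _ _ (Finset.mem_univ k), add_sub_cancel_left,
          Finset.sum_mul]
        exact Finset.sum_congr rfl fun j _ => by ring
      rw [h3]
      linear_combination (t k * e k) * hrel' k + (A - t k * U) * heρ k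
    simp_rw [h2]
    rw [Finset.sum_sub_distrib, Finset.sum_add_distrib, ← Finset.mul_sum, ← Finset.mul_sum,
      ← Finset.mul_sum, he1, ← hU, ← hA]
    ring
  have h1 : M ≤ M ^ ∑ k, (1 - ρ k) * e k := by
    calc M ≤ ∑ i, ∏ j, f j i ^ e j := Finset.sum_le_sum fun i _ => hpt i
      _ ≤ ∏ j, (∑ i, f j i) ^ e j := sum_prod_rpow_le _ _ _ _ hf0 (fun j _ => he0 j) he1
      _ ≤ _ := prod_rpow_le_of_le _ hM (fun j _ => he0 j)
          (fun j _ => Finset.sum_nonneg fun i _ => hf0 j i) fun k _ => by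
            have := H.self_weighted hb (δ := 1) hM
              (fun j => by simp only [Real.rpow_one]; exact (sum_marginal b j).le) k (hρ0 k)
              (hρ1 k).le (by rw [hrel, div_one])
            rwa [div_one] at this
  refine le_one_of_le_rpow ?_ h1
  have h2 : ∑ k, (1 - ρ k) * e k = 1 - U / Z := by
    have : ∀ k, (1 - ρ k) * e k = e k - τ k / Z := fun k => by rw [← heρ]; ring
    simp_rw [this]
    rw [Finset.sum_sub_distrib, he1, ← Finset.sum_div]
  have hU0 : 0 < U := by
    have h3 := hrel' (Classical.arbitrary κ)
    have h4 := hρ1 (Classical.arbitrary κ)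
    have h5 := mul_nonneg (hρ0 (Classical.arbitrary κ)).le (hτ (Classical.arbitrary κ))
    exact pos_of_mul_pos_right (show 0 < ρ (Classical.arbitrary κ) * U by linarith)
      (hρ0 (Classical.arbitrary κ)).le
  rw [h2]
  have := div_pos hU0 hZ0
  linarith

/-- The normalised marginals of `b ^ δ` are weights dominating `b ^ δ / ∑ b ^ δ`. -/
lemma exists_weights {b : (κ → I) → ℝ} (hb : ∀ i, 0 ≤ b i) {δ : ℝ} (hA : 0 < ∑ i, b i ^ δ) :
    ∃ w : κ → I → ℝ, (∀ j a, 0 ≤ w j a) ∧ (∀ j, ∑ a, w j a ≤ 1) ∧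
      ∀ j i, b i ^ δ / ∑ i, b i ^ δ ≤ w j (i j) := by
  have h0 : ∀ i, 0 ≤ b i ^ δ := fun i => Real.rpow_nonneg (hb i) _
  refine ⟨fun j a => marginal (fun i => b i ^ δ) j a / ∑ i, b i ^ δ,
    fun j a => div_nonneg (marginal_nonneg h0 j a) hA.le, fun j => ?_, fun j i => ?_⟩
  · rw [← Finset.sum_div, sum_marginal]
    exact div_self_le_one _
  · exact div_le_div_of_nonneg_right (le_marginal h0 j i) hA.le

/-- Bound when one of the outer exponents is not smaller than the inner one. -/
lemma WeightedMixedBound.sum_rpow_le_one_of_one_le {τ ρ : κ → ℝ} {b : (κ → I) → ℝ}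
    (H : WeightedMixedBound τ ρ b) (hb : ∀ i, 0 ≤ b i) {δ : ℝ} (hδ : 0 < δ)
    (hτ : ∀ k, 0 ≤ τ k) (k : κ) (hρ1 : 1 ≤ ρ k)
    (hrel : ρ k * ∑ j ∈ Finset.univ.erase k, τ j = 1 - ρ k / δ) :
    ∑ i, b i ^ δ ≤ 1 := by
  set A := ∑ i, b i ^ δ with hAdef
  rcases le_or_gt A 0 with hA | hA
  · linarith
  have hρ0 : 0 < ρ k := by linarith
  obtain ⟨w, hw0, hw1, hwb⟩ := exists_weights hb hA
  set c : (κ → I) → ℝ := fun i => (∏ j ∈ Finset.univ.erase k, w j (i j) ^ τ j) * b i with hc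
  have hc0 : ∀ i, 0 ≤ c i := fun i =>
    mul_nonneg (Finset.prod_nonneg fun j _ => Real.rpow_nonneg (hw0 _ _) _) (hb i)
  -- As ρ k ≥ 1, the ℓ¹ norm on each fibre dominates the ℓ^{ρ k} norm, so the mixed norm controls a
  -- plain power sum.
  have h1 : ∑ i, c i ^ ρ k ≤ 1 := by
    refine le_trans ?_ (H k w hw0 hw1)
    rw [← Finset.sum_fiberwise Finset.univ (fun i : κ → I => i k)]
    exact Finset.sum_le_sum fun a _ => sum_rpow_le_rpow_sum _ hρ1 c hc0
  have h2 : ∀ i, b i ^ δ / A ^ (1 - ρ k / δ) ≤ c i ^ ρ k := by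
    intro i
    rcases (hb i).eq_or_lt with h0 | h0
    · rw [← h0, Real.zero_rpow hδ.ne', zero_div]
      exact Real.rpow_nonneg (hc0 i) _
    have h3 : 0 < b i ^ δ / A := div_pos (Real.rpow_pos_of_pos h0 _) hA
    have h4 : (b i ^ δ / A) ^ (∑ j ∈ Finset.univ.erase k, τ j) * b i ≤ c i := by
      rw [Real.rpow_sum_of_pos h3]
      refine mul_le_mul_of_nonneg_right ?_ h0.le
      exact Finset.prod_le_prod (fun j _ => Real.rpow_nonneg h3.le _)
        fun j _ => Real.rpow_le_rpow h3.le (hwb j i) (hτ j)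
    refine le_trans (le_of_eq ?_) (Real.rpow_le_rpow (by positivity) h4 hρ0.le)
    rw [Real.mul_rpow (by positivity) h0.le, ← Real.rpow_mul h3.le, mul_comm _ (ρ k), hrel,
      Real.div_rpow (by positivity) hA.le, ← Real.rpow_mul h0.le, div_mul_eq_mul_div,
      ← Real.rpow_add h0]
    congr 2
    field_simp
    ring
  have h5 := (Finset.sum_le_sum fun i (_ : i ∈ Finset.univ) => h2 i).trans h1
  rw [← Finset.sum_div, ← hAdef, div_le_one (Real.rpow_pos_of_pos hA _)] at h5
  refine le_one_of_le_rpow ?_ h5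
  have := div_pos hρ0 hδ
  linarith

/-- Bound above the critical exponent. -/
lemma WeightedMixedBound.sum_rpow_le_one [Nonempty κ] {τ ρ : κ → ℝ} {b : (κ → I) → ℝ}
    (H : WeightedMixedBound τ ρ b) (hb : ∀ i, 0 ≤ b i) {δ : ℝ} (hδ : 1 ≤ δ)
    (hτ : ∀ k, 0 ≤ τ k) (hρ0 : ∀ k, 0 < ρ k)
    (hrel : ∀ k, ρ k * ∑ j ∈ Finset.univ.erase k, τ j = 1 - ρ k / δ) :
    ∑ i, b i ^ δ ≤ 1 := by
  have hδ0 : 0 < δ := by linarith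
  by_cases hρ1 : ∃ k, 1 ≤ ρ k
  · obtain ⟨k, hk⟩ := hρ1
    exact H.sum_rpow_le_one_of_one_le hb hδ0 hτ k hk (hrel k)
  push Not at hρ1
  set A := ∑ i, b i ^ δ with hAdef
  rcases le_or_gt A 0 with hA | hA
  · linarith
  obtain ⟨w, hw0, hw1, hwb⟩ := exists_weights hb hA
  set U := ∑ j, τ j with hU
  have hδ' : 0 ≤ 1 - 1 / δ := by rw [sub_nonneg, div_le_one hδ0]; exact hδ
  have hUE : ∀ k, U = τ k + ∑ j ∈ Finset.univ.erase k, τ j := fun k =>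
    (Finset.add_sum_erase _ _ (Finset.mem_univ k)).symm
  have hUgt : 1 - 1 / δ < U := by
    have k := Classical.arbitrary κ
    have h1 : ρ k * (1 - 1 / δ) < ρ k * ∑ j ∈ Finset.univ.erase k, τ j := by
      rw [hrel]; have := hρ1 k; ring_nf; linarith
    have := lt_of_mul_lt_mul_left h1 (hρ0 k).le
    linarith [hUE k, hτ k]
  have hU0 : 0 < U := by linarith
  -- The share c of each weight exponent is reserved for w, leaving 1 - c for arbitrary weights on
  -- b'. It is chosen so that b^δ / A^{1-1/δ} ≤ b', which turns the δ-sum of b into the plain sum of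
  -- b'.
  set c := (1 - 1 / δ) / U with hc
  have hc0 : 0 ≤ c := div_nonneg hδ' hU0.le
  have hc1 : c < 1 := (div_lt_one hU0).2 hUgt
  have hcU : c * U = 1 - 1 / δ := div_mul_cancel₀ _ hU0.ne'
  -- That is, 1/ρ' = 1/ρ + cτ: b' also carries the weight of slot k, absent from the k-th bound for
  -- b, and Hölder against w k costs this much. The new exponents satisfy the relation with δ = 1.
  set ρ' : κ → ℝ := fun k => ρ k / (1 + ρ k * (c * τ k)) with hρ'
  have hden : ∀ k, 1 ≤ 1 + ρ k * (c * τ k) := fun k => by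
    have := mul_nonneg (hρ0 k).le (mul_nonneg hc0 (hτ k)); linarith
  have hρ'0 : ∀ k, 0 < ρ' k := fun k => div_pos (hρ0 k) (by linarith [hden k])
  have hρ'1 : ∀ k, ρ' k < 1 := fun k => (div_le_self (hρ0 k).le (hden k)).trans_lt (hρ1 k)
  set b' : (κ → I) → ℝ := fun i => (∏ j, w j (i j) ^ (c * τ j)) * b i with hb'
  have hb'0 : ∀ i, 0 ≤ b' i := fun i =>
    mul_nonneg (Finset.prod_nonneg fun j _ => Real.rpow_nonneg (hw0 _ _) _) (hb i)
  have H' : WeightedMixedBound (fun j => (1 - c) * τ j) ρ' b' := by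
    intro k y hy0 hy1
    -- By AM–GM this convex combination, again an admissible weight, dominates y^{1-c} w^c.
    set z : κ → I → ℝ := fun j a => (1 - c) * y j a + c * w j a with hz
    have hz0 : ∀ j a, 0 ≤ z j a := fun j a =>
      add_nonneg (mul_nonneg (by linarith) (hy0 j a)) (mul_nonneg hc0 (hw0 j a))
    have hz1 : ∀ j, ∑ a, z j a ≤ 1 := fun j => by
      rw [hz, Finset.sum_add_distrib, ← Finset.mul_sum, ← Finset.mul_sum]
      nlinarith [hy1 j, hw1 j]
    have hk := H k z hz0 hz1
    set L : (κ → I) → ℝ := fun i => (∏ j ∈ Finset.univ.erase k, z j (i j) ^ τ j) * b i with hL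
    have hL0 : ∀ i, 0 ≤ L i := fun i =>
      mul_nonneg (Finset.prod_nonneg fun j _ => Real.rpow_nonneg (hz0 _ _) _) (hb i)
    have h1 : ∀ a, marginal (fun i => (∏ j ∈ Finset.univ.erase k, y j (i j) ^ ((1 - c) * τ j)) *
        b' i) k a ≤ w k a ^ (c * τ k) * marginal L k a := by
      intro a
      rw [marginal, marginal, Finset.mul_sum]
      refine Finset.sum_le_sum fun i hi => ?_
      have hia := (Finset.mem_filter.1 hi).2
      simp only [hb']
      rw [← Finset.mul_prod_erase _ _ (Finset.mem_univ k), hia]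
      have h2 : (∏ j ∈ Finset.univ.erase k, y j (i j) ^ ((1 - c) * τ j)) *
          ∏ j ∈ Finset.univ.erase k, w j (i j) ^ (c * τ j) ≤
          ∏ j ∈ Finset.univ.erase k, z j (i j) ^ τ j := by
        rw [← Finset.prod_mul_distrib]
        refine Finset.prod_le_prod (fun j _ => mul_nonneg (Real.rpow_nonneg (hy0 _ _) _)
          (Real.rpow_nonneg (hw0 _ _) _)) fun j _ => ?_
        rw [Real.rpow_mul (hy0 _ _), Real.rpow_mul (hw0 _ _),
          ← Real.mul_rpow (Real.rpow_nonneg (hy0 _ _) _) (Real.rpow_nonneg (hw0 _ _) _)]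
        exact Real.rpow_le_rpow (mul_nonneg (Real.rpow_nonneg (hy0 _ _) _)
          (Real.rpow_nonneg (hw0 _ _) _)) (Real.geom_mean_le_arith_mean2_weighted (by linarith) hc0
          (hy0 _ _) (hw0 _ _) (by ring)) (hτ j)
      calc _ = w k a ^ (c * τ k) * (((∏ j ∈ Finset.univ.erase k, y j (i j) ^ ((1 - c) * τ j)) *
          ∏ j ∈ Finset.univ.erase k, w j (i j) ^ (c * τ j)) * b i) := by ring
        _ ≤ w k a ^ (c * τ k) * L i := mul_le_mul_of_nonneg_left
            (mul_le_mul_of_nonneg_right h2 (hb i)) (Real.rpow_nonneg (hw0 _ _) _)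
    have hd : 1 + ρ k * (c * τ k) ≠ 0 := by linarith [hden k]
    have hm0 := fun a => marginal_nonneg hL0 k a
    have e0 : 0 ≤ c * τ k * ρ' k := mul_nonneg (mul_nonneg hc0 (hτ k)) (hρ'0 k).le
    have e1 : 0 ≤ ρ' k / ρ k := div_nonneg (hρ'0 k).le (hρ0 k).le
    have e2 : c * τ k * ρ' k + ρ' k / ρ k = 1 := by
      have := (hρ0 k).ne'
      rw [← div_self hd]
      simp only [hρ']; field_simp; ring
    calc _ ≤ ∑ a, (w k a ^ (c * τ k) * marginal L k a) ^ ρ' k :=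
          Finset.sum_le_sum fun a _ => Real.rpow_le_rpow (marginal_nonneg (fun i => mul_nonneg
            (Finset.prod_nonneg fun j _ => Real.rpow_nonneg (hy0 _ _) _) (hb'0 i)) _ _) (h1 a)
            (hρ'0 k).le
      _ = ∑ a, w k a ^ (c * τ k * ρ' k) * (marginal L k a ^ ρ k) ^ (ρ' k / ρ k) := by
          refine Finset.sum_congr rfl fun a _ => ?_
          rw [Real.mul_rpow (Real.rpow_nonneg (hw0 _ _) _) (hm0 a), ← Real.rpow_mul (hw0 _ _),
            ← Real.rpow_mul (hm0 a), mul_div_cancel₀ _ (hρ0 k).ne']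
      _ ≤ (∑ a, w k a) ^ (c * τ k * ρ' k) * (∑ a, marginal L k a ^ ρ k) ^ (ρ' k / ρ k) :=
          sum_rpow_mul_rpow_le _ e0 e1 e2 _ _ (hw0 k) fun a => Real.rpow_nonneg (hm0 a) _
      _ ≤ 1 := mul_le_one₀
          (Real.rpow_le_one (Finset.sum_nonneg fun a _ => hw0 k a) (hw1 k) e0)
          (Real.rpow_nonneg (Finset.sum_nonneg fun a _ => Real.rpow_nonneg (hm0 a) _) _)
          (Real.rpow_le_one (Finset.sum_nonneg fun a _ => Real.rpow_nonneg (hm0 a) _) hk e1)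
  have h1 := H'.sum_le_one hb'0 (fun k => mul_nonneg (by linarith) (hτ k)) hρ'0 hρ'1 fun k => by
    rw [← Finset.mul_sum]
    have hd : 1 + ρ k * (c * τ k) ≠ 0 := by linarith [hden k]
    simp only [hρ']
    rw [div_mul_eq_mul_div, div_eq_iff hd, show (1 - ρ k / (1 + ρ k * (c * τ k))) *
      (1 + ρ k * (c * τ k)) = 1 + ρ k * (c * τ k) - ρ k by rw [sub_mul, div_mul_cancel₀ _ hd]; ring]
    have h2 := hrel k
    have h3 := hUE k
    linear_combination h2 + c * ρ k * h3 - ρ k * hcU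
  have h2 : ∀ i, b i ^ δ / A ^ (1 - 1 / δ) ≤ b' i := by
    intro i
    rcases (hb i).eq_or_lt with h0 | h0
    · rw [← h0, Real.zero_rpow hδ0.ne', zero_div]
      exact hb'0 i
    have h3 : 0 < b i ^ δ / A := div_pos (Real.rpow_pos_of_pos h0 _) hA
    have h4 : (b i ^ δ / A) ^ (∑ j, c * τ j) * b i ≤ b' i := by
      rw [Real.rpow_sum_of_pos h3]
      refine mul_le_mul_of_nonneg_right ?_ h0.le
      exact Finset.prod_le_prod (fun j _ => Real.rpow_nonneg h3.le _)
        fun j _ => Real.rpow_le_rpow h3.le (hwb j i) (mul_nonneg hc0 (hτ j))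
    refine le_trans (le_of_eq ?_) h4
    rw [← Finset.mul_sum, ← hU, hcU, Real.div_rpow (by positivity) hA.le, ← Real.rpow_mul h0.le,
      div_mul_eq_mul_div, ← Real.rpow_add_one h0.ne']
    congr 2
    field_simp
    ring
  have h5 := (Finset.sum_le_sum fun i (_ : i ∈ Finset.univ) => h2 i).trans h1
  rw [← Finset.sum_div, ← hAdef, div_le_one (Real.rpow_pos_of_pos hA _)] at h5
  refine le_one_of_le_rpow ?_ h5
  have := one_div_pos.2 hδ0
  linarith

end Array

/-! ### Weighting and scaling weakly summable sequences -/

section WeakSequences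

variable {𝕜 : Type*} [RCLike 𝕜] {E : Type*} [NormedAddCommGroup E] [NormedSpace 𝕜 E]

/-- Tested on a norming functional of the sum. This keeps Rademacher sums in the unit ball, where
the summing constants are uniform. -/
lemma IsWeaklyBounded.norm_sum_smul_le {N : ℕ} {x : Fin N → E} (hx : IsWeaklyBounded 𝕜 1 x)
    (c : Fin N → 𝕜) (hc : ∀ a, ‖c a‖ ≤ 1) : ‖∑ a, c a • x a‖ ≤ 1 := by
  obtain ⟨φ, hφ, h⟩ := exists_dual_vector'' 𝕜 (∑ a, c a • x a)
  have h1 : ‖∑ a, c a • x a‖ = ‖φ (∑ a, c a • x a)‖ := by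
    rw [h]; simp
  rw [h1, map_sum]
  refine (norm_sum_le _ _).trans (le_trans (Finset.sum_le_sum fun a _ => ?_) (hx φ hφ))
  rw [map_smul, norm_smul, Real.rpow_one]
  exact mul_le_of_le_one_left (norm_nonneg _) (hc a)

/-- Multiplication by an element of `ℓ^{p^*}` turns weakly `p`-summable sequences into weakly
`1`-summable ones. -/
lemma IsWeaklyBounded.weighted {p : ℝ} (hp : 1 ≤ p) {N : ℕ} {x : Fin N → E}
    (hx : IsWeaklyBounded 𝕜 p x) {w : Fin N → ℝ} (hw0 : ∀ a, 0 ≤ w a) (hw1 : ∑ a, w a ≤ 1) :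
    IsWeaklyBounded 𝕜 1 fun a => ((w a ^ invConj p : ℝ) : 𝕜) • x a := by
  intro φ hφ
  have hp0 : 0 < p := by linarith
  have hu : 0 ≤ invConj p := by
    rw [invConj, sub_nonneg, div_le_one hp0]; exact hp
  have h := sum_rpow_mul_rpow_le Finset.univ hu (one_div_pos.2 hp0).le (by rw [invConj]; ring) w
    (fun a => ‖φ (x a)‖ ^ p) hw0 (fun a => by positivity)
  calc _ = ∑ a, w a ^ invConj p * (‖φ (x a)‖ ^ p) ^ (1 / p) := by
        refine Finset.sum_congr rfl fun a _ => ?_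
        rw [Real.rpow_one, map_smul, norm_smul, RCLike.norm_ofReal,
          abs_of_nonneg (Real.rpow_nonneg (hw0 a) _), one_div,
          Real.rpow_rpow_inv (norm_nonneg _) hp0.ne']
    _ ≤ _ := h
    _ ≤ 1 := mul_le_one₀ (Real.rpow_le_one (Finset.sum_nonneg fun a _ => hw0 a) hw1 hu)
        (by positivity) (Real.rpow_le_one (by positivity) (hx φ hφ) (by positivity))

lemma eq_zero_of_weakLpNorm_eq_zero {p : ℝ} (hp : 1 ≤ p) {x : ℕ → E}
    (hx : weakLpNorm 𝕜 p x = 0) (i : ℕ) : x i = 0 := by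
  have hp0 : 0 < p := by linarith
  obtain ⟨φ, hφ, h⟩ := exists_dual_vector'' 𝕜 (x i)
  have h1 := le_weakLpNorm p x hφ
  rw [hx, nonpos_iff_eq_zero, ENNReal.rpow_eq_zero_iff_of_pos (by positivity),
    ENNReal.tsum_eq_zero] at h1
  have h2 := h1 i
  rw [ENNReal.rpow_eq_zero_iff_of_pos hp0, h] at h2
  simpa using h2

lemma weakLpNorm_smul_le {p : ℝ} (hp : 1 ≤ p) (c : 𝕜) (x : ℕ → E) :
    weakLpNorm 𝕜 p (fun i => c • x i) ≤ ‖c‖ₑ * weakLpNorm 𝕜 p x := by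
  have hp0 : 0 < p := by linarith
  refine iSup₂_le fun φ hφ => ?_
  refine le_trans (le_of_eq ?_) (mul_le_mul_right (le_weakLpNorm p x hφ) _)
  simp_rw [map_smul, enorm_smul, ENNReal.mul_rpow_of_nonneg _ _ hp0.le]
  rw [ENNReal.tsum_mul_left, ENNReal.mul_rpow_of_nonneg _ _ (by positivity), one_div,
    ENNReal.rpow_rpow_inv hp0.ne']

end WeakSequences

/-! ### From cotype and summability to weighted mixed bounds -/

section MixedBound

variable {𝕜 : Type*} [RCLike 𝕜] {m : ℕ} {X : Fin m → Type*} {Y : Type*}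
    [∀ j, NormedAddCommGroup (X j)] [∀ j, NormedSpace 𝕜 (X j)]
    [NormedAddCommGroup Y] [NormedSpace 𝕜 Y]

/-- A partial Rademacher sum of the values of a multilinear map, the `k`-th index being fixed. -/
lemma norm_rademacher_multilinear (T : MultilinearMap 𝕜 X Y) {N : ℕ} (y : ∀ j, Fin N → X j)
    (k : Fin m) (a : Fin N) (ε : Fin m → Fin N → ℤˣ) :
    ‖∑ i : Fin m → Fin N, ((∏ j, ε j (i j) : ℤˣ) : ℤ) •
      (if i k = a then T (fun j => y j (i j)) else 0)‖ =
    ‖T (Function.update (fun j => ∑ b, ((ε j b : ℤ) : 𝕜) • y j b) k (y k a))‖ := by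
  -- The singleton in slot k makes the multilinear expansion run over the slice i k = a; the sign
  -- left in that slot disappears in the norm.
  set A : Fin m → Finset (Fin N) := fun j => if j = k then {a} else Finset.univ with hA
  have h1 := T.map_sum_finset (fun j b => ((ε j b : ℤ) : 𝕜) • y j b) A
  have hpi : Fintype.piFinset A = Finset.univ.filter fun i : Fin m → Fin N => i k = a := by
    ext i
    simp only [Fintype.mem_piFinset, Finset.mem_filter, Finset.mem_univ, true_and, hA]
    refine ⟨fun h => by simpa using h k, fun h j => ?_⟩
    split_ifs with hj
    · subst hj; simpa using h
    · exact Finset.mem_univ _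
  have harg : (fun j => ∑ b ∈ A j, ((ε j b : ℤ) : 𝕜) • y j b) =
      Function.update (fun j => ∑ b, ((ε j b : ℤ) : 𝕜) • y j b) k
        (((ε k a : ℤ) : 𝕜) • y k a) := by
    funext j
    by_cases hj : j = k
    · subst hj; simp [hA]
    · simp [hA, hj]
  have hsum : ∑ i : Fin m → Fin N, ((∏ j, ε j (i j) : ℤˣ) : ℤ) •
      (if i k = a then T (fun j => y j (i j)) else 0) =
      T (fun j => ∑ b ∈ A j, ((ε j b : ℤ) : 𝕜) • y j b) := by
    rw [h1, hpi, Finset.sum_filter]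
    refine Finset.sum_congr rfl fun i _ => ?_
    split_ifs
    · rw [T.map_smul_univ (fun j => ((ε j (i j) : ℤ) : 𝕜)) (fun j => y j (i j)),
        ← Int.cast_smul_eq_zsmul 𝕜]
      simp
    · simp
  rw [hsum, harg, T.map_update_smul, norm_smul]
  rcases Int.units_eq_one_or (ε k a) with h | h <;> simp [h]

/-- Coordinatewise summability and cotype give a mixed `(r, q)`-estimate. -/
lemma mixed_norm_bound (T : MultilinearMap 𝕜 X Y) {q C : ℝ} (hq : 1 ≤ q) (hC0 : 0 ≤ C)
    (hC : ∀ (n : ℕ) (y : Fin n → Y), (∑ i, ‖y i‖ ^ q) ^ (1 / q) ≤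
        C * ((∑ ε : Fin n → ℤˣ, ‖∑ i, (ε i : ℤ) • y i‖) / 2 ^ n))
    {r p K : ℝ} (hr : 1 ≤ r) (k : Fin m)
    (hK : ∀ (N : ℕ) (x : Fin N → X k), IsWeaklyBounded 𝕜 p x →
      ∀ z : (∀ j, X j), (∀ j ≠ k, ‖z j‖ ≤ 1) →
        ∑ a, ‖T (Function.update z k (x a))‖ ^ r ≤ K ^ r) (hK0 : 0 ≤ K)
    {N : ℕ} (y : ∀ j, Fin N → X j) (hy : ∀ j ≠ k, IsWeaklyBounded 𝕜 1 (y j))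
    (hyk : IsWeaklyBounded 𝕜 p (y k)) :
    ∑ a, (∑ i : Fin m → Fin N with i k = a, ‖T (fun j => y j (i j))‖ ^ q) ^ (r / q) ≤
      (C ^ m * K) ^ r := by
  have hq0 : 0 < q := by linarith
  have hr0 : 0 < r := by linarith
  set z : (Fin m → Fin N → ℤˣ) → ∀ j, X j := fun ε j => ∑ b, ((ε j b : ℤ) : 𝕜) • y j b with hz
  set D : ℝ := ((2 : ℝ) ^ N) ^ m with hD
  have hD0 : 0 < D := by positivity
  have hcard : ∑ _ε : Fin m → Fin N → ℤˣ, 1 / D = 1 := by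
    rw [Finset.sum_const, Finset.card_univ]
    simp [hD]
  have h1 : ∀ a, (∑ i : Fin m → Fin N with i k = a, ‖T (fun j => y j (i j))‖ ^ q) ^ (r / q) ≤
      (C ^ m) ^ r * ∑ ε, 1 / D * ‖T (Function.update (z ε) k (y k a))‖ ^ r := by
    intro a
    -- Cotype is applied to the full m-index array cut off to the slice. The signs in direction k
    -- are superfluous but harmless, which is why the constant is C ^ m.
    have h2 := iterated_cotype hq hC0 hC N m
      fun i => if i k = a then T (fun j => y j (i j)) else 0
    simp_rw [norm_rademacher_multilinear T y k a] at h2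
    have h3 : ∑ i : Fin m → Fin N, ‖if i k = a then T (fun j => y j (i j)) else 0‖ ^ q =
        ∑ i : Fin m → Fin N with i k = a, ‖T (fun j => y j (i j))‖ ^ q := by
      rw [Finset.sum_filter]
      refine Finset.sum_congr rfl fun i _ => ?_
      split_ifs
      · rfl
      · simp [hq0.ne']
    rw [h3] at h2
    have h4 := Real.rpow_le_rpow (by positivity) h2 hr0.le
    rw [← Real.rpow_mul (by positivity), one_div_mul_eq_div,
      Real.mul_rpow (by positivity) (by positivity)] at h4
    refine h4.trans (mul_le_mul_of_nonneg_left ?_ (by positivity))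
    rw [Finset.sum_div]
    simp_rw [div_eq_inv_mul _ (((2 : ℝ) ^ N) ^ m), ← one_div]
    exact Real.rpow_arith_mean_le_arith_mean_rpow _ _ _ (fun _ _ => by positivity) hcard
      (fun _ _ => norm_nonneg _) hr
  refine (Finset.sum_le_sum fun a _ => h1 a).trans ?_
  rw [← Finset.mul_sum, Finset.sum_comm, Real.mul_rpow (by positivity) hK0]
  refine mul_le_mul_of_nonneg_left ?_ (by positivity)
  calc _ ≤ ∑ _ε : Fin m → Fin N → ℤˣ, 1 / D * K ^ r := by
        refine Finset.sum_le_sum fun ε _ => ?_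
        rw [← Finset.mul_sum]
        refine mul_le_mul_of_nonneg_left (hK N (y k) hyk (z ε) fun j hj => ?_) (by positivity)
        refine (hy j hj).norm_sum_smul_le _ fun b => ?_
        rcases Int.units_eq_one_or (ε j b) with h | h <;> simp [h]
    _ = K ^ r := by rw [← Finset.sum_mul, hcard, one_mul]

/-- The array of the (normalised) values of `T` satisfies the weighted mixed bounds. -/
lemma exists_weightedMixedBound [∀ j, CompleteSpace (X j)] (T : MultilinearMap 𝕜 X Y) {q : ℝ}
    (hY : HasCotype Y q) {r p : Fin m → ℝ} (hr : ∀ k, 1 ≤ r k) (hp : ∀ k, 1 ≤ p k)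
    (hT : ∀ k, IsSummingInCoord (r k) (p k) k T) :
    ∃ K : ℝ, 0 < K ∧ ∀ (N : ℕ) (x : ∀ j, Fin N → X j), (∀ j, IsWeaklyBounded 𝕜 (p j) (x j)) →
      WeightedMixedBound (fun j => q * invConj (p j)) (fun k => r k / q)
        fun i : Fin m → Fin N => (‖T fun j => x j (i j)‖ / K) ^ q := by
  let _ : NormedSpace ℝ Y := NormedSpace.restrictScalars ℝ 𝕜 Y
  have hq : 1 ≤ q := by linarith [hY.1]
  have hq0 : 0 < q := by linarith
  obtain ⟨C, hC0, hC⟩ := hY.exists_l1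
  choose L hL0 hL using exists_uniform_summing_bound T hr hp hT
  have hCL : ∀ k, 0 ≤ C ^ m * L k := fun k => mul_nonneg (by positivity) (hL0 k)
  have hS : 0 ≤ ∑ k, C ^ m * L k := Finset.sum_nonneg fun k _ => hCL k
  refine ⟨∑ k, C ^ m * L k + 1, by linarith, fun N x hx k w hw0 hw1 => ?_⟩
  set K := ∑ k, C ^ m * L k + 1 with hKdef
  have hK0 : 0 < K := by linarith
  have hKk : C ^ m * L k ≤ K := by
    have := Finset.single_le_sum (fun k _ => hCL k) (Finset.mem_univ k)
    linarith
  -- Slot k stays unweighted: it enters through the summing inequality, which asks only for weak p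
  -- k-boundedness.
  set c : Fin m → Fin N → ℝ := fun j b => if j = k then 1 else w j b ^ invConj (p j) with hc
  have hc0 : ∀ j b, 0 ≤ c j b := by
    intro j b
    simp only [hc]
    split_ifs
    · exact zero_le_one
    · exact Real.rpow_nonneg (hw0 _ _) _
  set y : ∀ j, Fin N → X j := fun j b => (c j b : 𝕜) • x j b with hy
  have hyk : y k = x k := by funext b; simp [hy, hc]
  have hyj : ∀ j ≠ k, IsWeaklyBounded 𝕜 1 (y j) := by
    intro j hj
    have := (hx j).weighted (hp j) (hw0 j) (hw1 j)
    simpa only [hy, hc, hj, if_false] using this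
  have hb := mixed_norm_bound T hq hC0 hC (hr k) k (hL k) (hL0 k) y hyj (by rw [hyk]; exact hx k)
  have hval : ∀ i : Fin m → Fin N, (∏ j ∈ Finset.univ.erase k, w j (i j) ^ (q * invConj (p j))) *
      (‖T fun j => x j (i j)‖ / K) ^ q = ‖T fun j => y j (i j)‖ ^ q / K ^ q := by
    intro i
    have hprod : ∏ j, c j (i j) = ∏ j ∈ Finset.univ.erase k, w j (i j) ^ invConj (p j) := by
      rw [← Finset.mul_prod_erase _ _ (Finset.mem_univ k)]
      simp only [hc, if_true, one_mul]
      exact Finset.prod_congr rfl fun j hj => by simp only [Finset.ne_of_mem_erase hj, if_false]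
    have hn : ‖T fun j => y j (i j)‖ =
        (∏ j ∈ Finset.univ.erase k, w j (i j) ^ invConj (p j)) * ‖T fun j => x j (i j)‖ := by
      simp only [hy]
      rw [T.map_smul_univ (fun j => (c j (i j) : 𝕜)) (fun j => x j (i j)), norm_smul, ← hprod,
        norm_prod]
      congr 1
      exact Finset.prod_congr rfl fun j _ => by
        rw [RCLike.norm_ofReal, abs_of_nonneg (hc0 _ _)]
    rw [hn, Real.mul_rpow (Finset.prod_nonneg fun j _ => Real.rpow_nonneg (hw0 _ _) _)
      (norm_nonneg _), Real.div_rpow (norm_nonneg _) hK0.le,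
      ← Real.finsetProd_rpow _ _ fun j _ => Real.rpow_nonneg (hw0 _ _) _, mul_div_assoc]
    congr 1
    exact Finset.prod_congr rfl fun j _ => by rw [← Real.rpow_mul (hw0 _ _), mul_comm]
  have hr0 : 0 < r k := by linarith [hr k]
  calc _ = (∑ a, (∑ i : Fin m → Fin N with i k = a, ‖T (fun j => y j (i j))‖ ^ q) ^ (r k / q)) /
        K ^ r k := by
        rw [Finset.sum_div]
        refine Finset.sum_congr rfl fun a _ => ?_
        simp_rw [marginal, hval]
        rw [← Finset.sum_div, Real.div_rpow (by positivity) (by positivity),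
          ← Real.rpow_mul hK0.le, mul_div_cancel₀ _ hq0.ne']
    _ ≤ (C ^ m * L k) ^ r k / K ^ r k := by gcongr
    _ ≤ 1 := (div_le_one (by positivity)).2 (Real.rpow_le_rpow (hCL k) hKk hr0.le)

end MixedBound

/-! ### From finite sequences to multiple summability -/

section Multiple

variable {𝕜 : Type*} [RCLike 𝕜] {m : ℕ} {X : Fin m → Type*} {Y : Type*}
    [∀ j, NormedAddCommGroup (X j)] [∀ j, NormedSpace 𝕜 (X j)]
    [NormedAddCommGroup Y] [NormedSpace 𝕜 Y]

lemma tsum_pi_nat_le {f : (Fin m → ℕ) → ℝ≥0∞} {B : ℝ≥0∞}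
    (h : ∀ N : ℕ, ∑ i : Fin m → Fin N, f (fun j => i j) ≤ B) : ∑' i, f i ≤ B := by
  classical
  refine ENNReal.summable.tsum_le_of_sum_le fun F => ?_
  set N := (F.sup fun i => Finset.univ.sup i) + 1 with hN
  have hinj : Function.Injective fun (i : Fin m → Fin N) (j : Fin m) => (i j : ℕ) := by
    intro i i' hii
    funext j
    exact Fin.ext (congrFun hii j)
  refine le_trans ?_ (h N)
  rw [← Finset.sum_image (f := f) (s := Finset.univ) (fun i _ i' _ h => hinj h)]
  refine Finset.sum_le_sum_of_subset fun i hi => ?_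
  rw [Finset.mem_image]
  refine ⟨fun j => ⟨i j, ?_⟩, Finset.mem_univ _, rfl⟩
  rw [hN, Nat.lt_succ_iff]
  exact (Finset.le_sup (f := i) (Finset.mem_univ j)).trans
    (Finset.le_sup (f := fun i : Fin m → ℕ => Finset.univ.sup i) hi)

/-- Multiple summability follows from a bound for finite sequences of weak norm at most one. -/
lemma isMultipleSumming_of_finite (T : MultilinearMap 𝕜 X Y) {s K : ℝ} {p : Fin m → ℝ}
    (hs : 0 < s) (hp : ∀ k, 1 ≤ p k) (hK : 0 < K)
    (h : ∀ (N : ℕ) (x : ∀ j, Fin N → X j), (∀ j, IsWeaklyBounded 𝕜 (p j) (x j)) →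
      ∑ i : Fin m → Fin N, (‖T fun j => x j (i j)‖ / K) ^ s ≤ 1) :
    IsMultipleSumming s p T := by
  refine ⟨K.toNNReal, Real.toNNReal_pos.2 hK, fun x => ?_⟩
  -- Treated first because another factor may be infinite and 0 * ∞ = 0; here T vanishes on the
  -- whole array.
  by_cases h0 : ∃ j, weakLpNorm 𝕜 (p j) (x j) = 0
  · obtain ⟨j, hj⟩ := h0
    have hx := eq_zero_of_weakLpNorm_eq_zero (hp j) hj
    have hz : ∀ i : Fin m → ℕ, T (fun j => x j (i j)) = 0 := fun i => T.map_coord_zero j (hx _)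
    simp [hz, hs]
  push Not at h0
  by_cases htop : ∃ j, weakLpNorm 𝕜 (p j) (x j) = ⊤
  · obtain ⟨j, hj⟩ := htop
    rw [← Finset.mul_prod_erase _ _ (Finset.mem_univ j), hj,
      ENNReal.top_mul (Finset.prod_ne_zero_iff.2 fun j _ => h0 j), ENNReal.mul_top]
    · exact le_top
    · simpa using hK
  push Not at htop
  set ω : Fin m → ℝ := fun j => (weakLpNorm 𝕜 (p j) (x j)).toReal with hω
  have hω0 : ∀ j, 0 < ω j := fun j => ENNReal.toReal_pos (h0 j) (htop j)
  have hωW : ∀ j, ENNReal.ofReal (ω j) = weakLpNorm 𝕜 (p j) (x j) :=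
    fun j => ENNReal.ofReal_toReal (htop j)
  set x' : ∀ j, ℕ → X j := fun j i => (((ω j)⁻¹ : ℝ) : 𝕜) • x j i with hx'
  have hweak : ∀ j, weakLpNorm 𝕜 (p j) (x' j) ≤ 1 := by
    intro j
    refine (weakLpNorm_smul_le (hp j) _ _).trans (le_of_eq ?_)
    rw [← hωW j, ← ofReal_norm, RCLike.norm_ofReal, abs_of_pos (inv_pos.2 (hω0 j)),
      ← ENNReal.ofReal_mul (inv_pos.2 (hω0 j)).le, inv_mul_cancel₀ (hω0 j).ne', ENNReal.ofReal_one]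
  have hTx : ∀ i : Fin m → ℕ, ‖T fun j => x j (i j)‖ₑ =
      (ENNReal.ofReal K * ∏ j, weakLpNorm 𝕜 (p j) (x j)) *
        ENNReal.ofReal (‖T fun j => x' j (i j)‖ / K) := by
    intro i
    have h1 : ‖T fun j => x j (i j)‖ = K * (∏ j, ω j) * (‖T fun j => x' j (i j)‖ / K) := by
      simp only [hx']
      rw [T.map_smul_univ (fun j => (((ω j)⁻¹ : ℝ) : 𝕜)) (fun j => x j (i j)), norm_smul,
        norm_prod]
      simp only [RCLike.norm_ofReal, abs_inv, abs_of_pos (hω0 _), Finset.prod_inv_distrib]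
      have : ∏ j, ω j ≠ 0 := Finset.prod_ne_zero_iff.2 fun j _ => (hω0 j).ne'
      field_simp
    have hP : 0 ≤ ∏ j, ω j := Finset.prod_nonneg fun j _ => (hω0 j).le
    rw [← ofReal_norm, h1, ENNReal.ofReal_mul (mul_nonneg hK.le hP), ENNReal.ofReal_mul hK.le,
      ENNReal.ofReal_prod_of_nonneg fun j _ => (hω0 j).le]
    simp_rw [hωW]
  simp_rw [hTx, ENNReal.mul_rpow_of_nonneg _ _ hs.le]
  rw [ENNReal.tsum_mul_left, ENNReal.mul_rpow_of_nonneg _ _ (by positivity)]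
  have hB : ∑' i : Fin m → ℕ, ENNReal.ofReal (‖T fun j => x' j (i j)‖ / K) ^ s ≤ 1 := by
    refine tsum_pi_nat_le fun N => ?_
    have h1 := h N (fun j a => x' j a) fun j => isWeaklyBounded_of_weakLpNorm_le (hp j) (hweak j) N
    rw [← ENNReal.ofReal_le_one, ENNReal.ofReal_sum_of_nonneg (fun _ _ => by positivity)] at h1
    refine le_trans (le_of_eq ?_) h1
    exact Finset.sum_congr rfl fun i _ =>
      ENNReal.ofReal_rpow_of_nonneg (div_nonneg (norm_nonneg _) hK.le) hs.le
  rw [← ENNReal.mul_rpow_of_nonneg _ _ hs.le, one_div, ENNReal.rpow_rpow_inv hs.ne']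
  exact mul_le_of_le_one_right' (ENNReal.rpow_le_one hB (by positivity))

end Multiple

/-! ### The main theorem -/

theorem corollary2p6 {𝕜 : Type*} [RCLike 𝕜] {m : ℕ} (hm : 1 ≤ m)
    {X : Fin m → Type*} {Y : Type*}
    [∀ j, NormedAddCommGroup (X j)] [∀ j, NormedSpace 𝕜 (X j)] [∀ j, CompleteSpace (X j)]
    [NormedAddCommGroup Y] [NormedSpace 𝕜 Y] [CompleteSpace Y]
    (T : MultilinearMap 𝕜 X Y) (q : ℝ) (hY : HasCotype Y q)
    (r p : Fin m → ℝ) (hr : ∀ k, 1 ≤ r k) (hp : ∀ k, 1 ≤ p k)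
    (hT : ∀ k, IsSummingInCoord (r k) (p k) k T)
    (θ : ℝ) (hθ : θ ≤ 0) (hrp : ∀ k, 1 / r k - 1 / p k = θ)
    (γ : ℝ) (hγ : 1 / γ = 1 + θ - ∑ k, invConj (p k)) :
    (0 < γ → γ < q → ∀ s : ℝ, 1 / s = ((m : ℝ) - 1) / (m * q) + 1 / (γ * m) →
      IsMultipleSumming s p T) ∧
    (q ≤ γ → IsMultipleSumming γ p T) := by
  have hq0 : 0 < q := by linarith [hY.1]
  have : Nonempty (Fin m) := ⟨⟨0, hm⟩⟩
  obtain ⟨K, hK, hb⟩ := exists_weightedMixedBound T hY hr hp hT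
  have hτ : ∀ k, 0 ≤ q * invConj (p k) := fun k => by
    refine mul_nonneg hq0.le ?_
    rw [invConj, sub_nonneg, div_le_one (by linarith [hp k])]
    exact hp k
  have hρ0 : ∀ k, 0 < r k / q := fun k => div_pos (by linarith [hr k]) hq0
  have hrel : 0 < γ → ∀ k, r k / q * ∑ j ∈ Finset.univ.erase k, q * invConj (p j) =
      1 - r k / q / (γ / q) := by
    intro hγ0 k
    -- The common value θ makes the same γ serve every k, which is what puts one δ = γ/q into all
    -- the relations.
    have h1 : ∑ j ∈ Finset.univ.erase k, invConj (p j) = 1 / r k - 1 / γ := by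
      have h2 := Finset.add_sum_erase Finset.univ (fun j => invConj (p j)) (Finset.mem_univ k)
      have h3 : invConj (p k) = 1 - 1 / p k := rfl
      linarith [hrp k]
    have hrk : r k ≠ 0 := by linarith [hr k]
    rw [← Finset.mul_sum, h1]
    field_simp
  have hb0 : ∀ (N : ℕ) (x : ∀ j, Fin N → X j) (i : Fin m → Fin N),
      0 ≤ (‖T fun j => x j (i j)‖ / K) ^ q := fun N x i => by positivity
  have hpow : ∀ (N : ℕ) (x : ∀ j, Fin N → X j) (i : Fin m → Fin N) (t : ℝ),
      (‖T fun j => x j (i j)‖ / K) ^ t = ((‖T fun j => x j (i j)‖ / K) ^ q) ^ (t / q) :=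
    fun N x i t => by rw [← Real.rpow_mul (by positivity), mul_div_cancel₀ _ hq0.ne']
  have hm0 : (1 : ℝ) ≤ m := by exact_mod_cast hm
  refine ⟨fun hγ0 hγq s hs => ?_, fun hγq => ?_⟩
  · have hs0 : 0 < s := by
      rw [← one_div_pos, hs]
      have : 0 ≤ ((m : ℝ) - 1) / (m * q) := div_nonneg (by linarith) (by positivity)
      positivity
    refine isMultipleSumming_of_finite T hs0 hp hK fun N x hx => ?_
    have hδ1 : γ / q < 1 := (div_lt_one hq0).2 hγq
    have h1 := (hb N x hx).sum_marginal_rpow_le (hb0 N x) (div_pos hγ0 hq0) hδ1 hτ hρ0 (hrel hγ0)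
    have h2 := sum_rpow_le_one_of_mixed (hb0 N x) (div_pos hγ0 hq0) hδ1 h1 (σ := s / q) (by
      rw [one_div_div, div_eq_mul_one_div, hs, Fintype.card_fin]
      field_simp)
    simp_rw [hpow N x _ s]
    exact h2
  · have hγ0 : 0 < γ := by linarith
    refine isMultipleSumming_of_finite T hγ0 hp hK fun N x hx => ?_
    have h1 := (hb N x hx).sum_rpow_le_one (hb0 N x) ((one_le_div hq0).2 hγq) hτ hρ0 (hrel hγ0)
    simp_rw [hpow N x _ γ]
    exact h1
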